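/- **Conventions.** Rings are associative with unit, bimodules are unital. For a map $f$ into an abelian group write $\langle f\rangle(x,y)=f(x)+f(y)-f(x+y)$. **Mac Lane cohomology.** Let $R$ be a ring and $B$ an $R$-bimodule. $C^3(R;B)$ is the group (under valuewise addition) of quadruples $\varphi=(\varphi_\cdot,\varphi_{\cdot+},\varphi_{+\cdot},\varphi_+)$ of maps $\varphi_\cdot,\varphi_{\cdot+},\varphi_{+\cdot}:R^3\to B$, $\varphi_+:R^4\to B$ (the arguments of $\varphi_+$ are written as $2\times2$ matrices) that are normalized: $\varphi_\cdot,\varphi_{\cdot+},\varphi_{+\cdot}$ vanish if one argument is $0$, and $\varphi_+$ vanishes on all matrices $\left(\begin{smallmatrix}x&y\\0&0\end{smallmatrix}\right)$, $\left(\begin{smallmatrix}0&0\\x&y\end{smallmatrix}\right)$, $\left(\begin{smallmatrix}x&0\\y&0\end{smallmatrix}\right)$, $\left(\begin{smallmatrix}0&x\\0&y\end{smallmatrix}\right)$, $\left(\begin{smallmatrix}x&0\\0&y\end{smallmatrix}\right)$. $Z^3(R;B)$ is the subgroup of those that satisfy, for all elements of $R$, 1. $r\varphi_\cdot(s,t,u)-\varphi_\cdot(rs,t,u)+\varphi_\cdot(r,st,u)-\varphi_\cdot(r,s,tu)+\varphi_\cdot(r,s,t)u=0$;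 2. $r\varphi_{\cdot+}(s,t_0,t_1)-\varphi_{\cdot+}(rs,t_0,t_1)+\varphi_{\cdot+}(r,st_0,st_1)=\langle\varphi_\cdot(r,s,-)\rangle(t_0,t_1)$; 3. $\varphi_{\cdot+}(r,s_0t,s_1t)-\varphi_{\cdot+}(r,s_0,s_1)t=\varphi_{+\cdot}(rs_0,rs_1,t)-r\varphi_{+\cdot}(s_0,s_1,t)+\langle\varphi_\cdot(r,-,t)\rangle(s_0,s_1)$; 4. $\varphi_{+\cdot}(r_0s,r_1s,t)-\varphi_{+\cdot}(r_0,r_1,st)+\varphi_{+\cdot}(r_0,r_1,s)t=-\langle\varphi_\cdot(-,s,t)\rangle(r_0,r_1)$; 5. $\varphi_+\left(\begin{smallmatrix}rs_{00}&rs_{01}\\rs_{10}&rs_{11}\end{smallmatrix}\right)-r\varphi_+\left(\begin{smallmatrix}s_{00}&s_{01}\\s_{10}&s_{11}\end{smallmatrix}\right)=\langle\varphi_{\cdot+}(r,-,-)\rangle((s_{00},s_{10}),(s_{01},s_{11}))-\langle\varphi_{\cdot+}(r,-,-)\rangle((s_{00},s_{01}),(s_{10},s_{11}))$; 6. $\varphi_+\left(\begin{smallmatrix}r_0s_0&r_0s_1\\r_1s_0&r_1s_1\end{smallmatrix}\right)=\langle\varphi_{+\cdot}(r_0,r_1,-)\rangle(s_0,s_1)-\langle\varphi_{\cdot+}(-,s_0,s_1)\rangle(r_0,r_1)$;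 7. $\varphi_+\left(\begin{smallmatrix}r_{00}s&r_{01}s\\r_{10}s&r_{11}s\end{smallmatrix}\right)-\varphi_+\left(\begin{smallmatrix}r_{00}&r_{01}\\r_{10}&r_{11}\end{smallmatrix}\right)s=\langle\varphi_{+\cdot}(-,-,s)\rangle((r_{00},r_{10}),(r_{01},r_{11}))-\langle\varphi_{+\cdot}(-,-,s)\rangle((r_{00},r_{01}),(r_{10},r_{11}))$; 8. $\langle\varphi_+\rangle\left(\left(\begin{smallmatrix}r_{000}&r_{001}\\r_{010}&r_{011}\end{smallmatrix}\right),\left(\begin{smallmatrix}r_{100}&r_{101}\\r_{110}&r_{111}\end{smallmatrix}\right)\right)-\langle\varphi_+\rangle\left(\left(\begin{smallmatrix}r_{000}&r_{001}\\r_{100}&r_{101}\end{smallmatrix}\right),\left(\begin{smallmatrix}r_{010}&r_{011}\\r_{110}&r_{111}\end{smallmatrix}\right)\right)+\langle\varphi_+\rangle\left(\left(\begin{smallmatrix}r_{000}&r_{010}\\r_{100}&r_{110}\end{smallmatrix}\right),\left(\begin{smallmatrix}r_{001}&r_{011}\\r_{101}&r_{111}\end{smallmatrix}\right)\right)=0$.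 $B^3(R;B)\subseteq Z^3(R;B)$ is the subgroup of those $\varphi\in C^3(R;B)$ for which there are maps $\gamma_\cdot,\gamma_+:R^2\to B$ with $\varphi_\cdot(r,s,t)=r\gamma_\cdot(s,t)-\gamma_\cdot(rs,t)+\gamma_\cdot(r,st)-\gamma_\cdot(r,s)t$, $\ \varphi_{\cdot+}(r,s_0,s_1)=r\gamma_+(s_0,s_1)-\gamma_+(rs_0,rs_1)+\langle\gamma_\cdot(r,-)\rangle(s_0,s_1)$, $\ \varphi_{+\cdot}(r_0,r_1,s)=\gamma_+(r_0,r_1)s-\gamma_+(r_0s,r_1s)+\langle\gamma_\cdot(-,s)\rangle(r_0,r_1)$ and $\varphi_+\left(\begin{smallmatrix}r_{00}&r_{01}\\r_{10}&r_{11}\end{smallmatrix}\right)=\langle\gamma_+\rangle((r_{00},r_{01}),(r_{10},r_{11}))-\langle\gamma_+\rangle((r_{00},r_{10}),(r_{01},r_{11}))$. Put $H^3(R;B)=Z^3(R;B)/B^3(R;B)$. **Categorical rings.** A categorical ring $\mathscr R$ is a symmetric monoidal groupoid $(\mathscr R,+,0)$ with a chosen object $-a$ and a chosen isomorphism $-a+a\to0$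 for each object $a$, together with a second monoidal structure $(\cdot,1)$ on $\mathscr R$ and natural isomorphisms $r(s_0+s_1)\to rs_0+rs_1$ and $(r_0+r_1)s\to r_0s+r_1s$ such that - the two canonical isomorphisms built from the distributivity and multiplicative associativity constraints agree in each of the cases $(rs)(t_0+t_1)\to r(st_0)+r(st_1)$, $(r(s_0+s_1))t\to r(s_0t)+r(s_1t)$, $((r_0+r_1)s)t\to r_0(st)+r_1(st)$; - the distributivity constraints at $1(r_0+r_1)$ and $(r_0+r_1)1$ are compatible with the multiplicative unit constraints; - the distributivity constraints are compatible with the canonical interchange isomorphisms $(a+b)+(c+d)\to(a+c)+(b+d)$: the two canonical isomorphisms $r((s_{00}+s_{01})+(s_{10}+s_{11}))\to(rs_{00}+rs_{10})+(rs_{01}+rs_{11})$ agree, likewise for multiplication by $s$ on the right, and the two canonical isomorphisms $(r_0+r_1)(s_0+s_1)\to(r_0s_0+r_1s_0)+(r_0s_1+r_1s_1)$ agree; - with the distributivity constraints, all functors $r\cdot(-)$ and $(-)\cdot s$ are monoidal functors with respect to $+$. A 2-homomorphism of categorical rings is a functor $f$ with structures of a monoidal functor with respect to $+$ and with respect to $\cdot$,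 with structure morphisms $f(r_0)+f(r_1)\to f(r_0+r_1)$ and $f(r)f(s)\to f(rs)$ that are compatible with both distributivity constraints. $\pi_0(\mathscr R)$ is the ring of isomorphism classes of objects of $\mathscr R$, and $\pi_1(\mathscr R)$ is the abelian group $\mathrm{Aut}(0)$, a $\pi_0(\mathscr R)$-bimodule through multiplication and the canonical isomorphisms $r0\cong0\cong0r$. $\mathrm{Crext}(R;B)$ is the class of categorical rings $\mathscr R$ with $\pi_0(\mathscr R)=R$ and $\pi_1(\mathscr R)=B$ (as identifications of rings and of abelian groups) whose induced bimodule structure is the given one, modulo the relation: $\mathscr R\sim\mathscr R'$ if there is a 2-homomorphism $\mathscr R\to\mathscr R'$ that induces the identity on $\pi_0$ and $\pi_1$. *Characteristic cochains.* For $\mathscr R$ as above, choose an object $\bar r$ in each class $r\in R$ and morphisms $\sigma_\cdot(r,s):\bar r\bar s\to\overline{rs}$, $\sigma_+(r,s):\bar r+\bar s\to\overline{r+s}$. For parallel morphisms $\alpha,\alpha'$ let $\alpha'-\alpha\in B$ be the unique element $\beta$ such that $\alpha+\beta$ corresponds to $\alpha'$ under the right unit constraints of $+$. The characteristic cochain of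 these choices is the quadruple with $$\varphi_\cdot(r,s,t)=\sigma_\cdot(r,st)\circ\bar r\sigma_\cdot(s,t)\circ a-\sigma_\cdot(rs,t)\circ\sigma_\cdot(r,s)\bar t,$$ $$\varphi_{\cdot+}(r,s_0,s_1)=\sigma_+(rs_0,rs_1)\circ(\sigma_\cdot(r,s_0)+\sigma_\cdot(r,s_1))\circ d-\sigma_\cdot(r,s_0+s_1)\circ\bar r\sigma_+(s_0,s_1),$$ $$\varphi_{+\cdot}(r_0,r_1,s)=\sigma_+(r_0s,r_1s)\circ(\sigma_\cdot(r_0,s)+\sigma_\cdot(r_1,s))\circ d'-\sigma_\cdot(r_0+r_1,s)\circ\sigma_+(r_0,r_1)\bar s,$$ $$\varphi_+\left(\begin{smallmatrix}r_{00}&r_{01}\\r_{10}&r_{11}\end{smallmatrix}\right)=\sigma_+(r_{00}+r_{10},r_{01}+r_{11})\circ(\sigma_+(r_{00},r_{10})+\sigma_+(r_{01},r_{11}))\circ c-\sigma_+(r_{00}+r_{01},r_{10}+r_{11})\circ(\sigma_+(r_{00},r_{01})+\sigma_+(r_{10},r_{11})),$$ where $a,d,d',c$ are the multiplicative associativity,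 left and right distributivity and interchange isomorphisms at the chosen objects. *Skeletal construction.* For $\varphi\in Z^3(R;B)$, $\mathscr R_\varphi$ is the categorical ring with objects the elements of $R$ and morphisms the pairs $(b,r):r\to r$, $b\in B$, with $(b,r)\circ(b',r)=(b+b',r)$, $(b_0,r_0)+(b_1,r_1)=(b_0+b_1,r_0+r_1)$, $(b,r)(b',r')=(br'+rb',rr')$, neutral objects $0$ and $1$, trivial additive unit constraints, and all other constraints given by their $B$-components: additive associativity $\varphi_+\left(\begin{smallmatrix}r&s\\0&t\end{smallmatrix}\right)$, symmetry $\varphi_+\left(\begin{smallmatrix}0&r\\s&0\end{smallmatrix}\right)$, multiplicative associativity $\varphi_\cdot(r,s,t)$, multiplicative unit constraints $-\varphi_\cdot(1,1,r)$ (left) and $\varphi_\cdot(r,1,1)$ (right), distributivity $\varphi_{\cdot+}(r,s_0,s_1)$ (left) and $\varphi_{+\cdot}(r_0,r_1,s)$ (right). **Theorem.** For any ring $R$ and any $R$-bimodule $B$, the relation $\sim$ is an equivalence relation, and there is a bijection $$H^3(R;B)\cong\mathrm{Crext}(R;B)$$ which sends the class of a cocycle $\varphi$ to the class of $\mathscr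 R_\varphi$, and whose inverse sends the class of $\mathscr R$ to its characteristic class $[\mathscr R]$: every $\mathscr R$ has a normalized characteristic cochain, every normalized characteristic cochain of $\mathscr R$ is a cocycle, and its class in $H^3(R;B)$ corresponds to the class of $\mathscr R$. -/

import Mathlib

open CategoryTheory MonoidalCategory
open scoped RightActions

universe v u

/-! ### Categorical rings

The additive structure of a categorical ring is written through the ambient Mathlib instances:
`a ⊗ b` is the sum of the objects `a`, `b`, `f ⊗ₘ g` the sum of morphisms, `𝟙_ C` the zero object,
`α_`, `λ_`, `ρ_`, `β_` the additive constraints.  The multiplicative structure is a second monoidal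
structure, written `r ⊙ s`, `f ⊙ₘ g`. -/

/-- A categorical group: a monoidal groupoid with a chosen inverse `neg a` of every object `a` and
a chosen (iso)morphism `neg a + a ⟶ 0`. -/
class CategoricalGroup (C : Type u) [Groupoid.{v} C] [MonoidalCategory C] where
  neg : C → C
  negHom : ∀ a : C, neg a ⊗ a ⟶ 𝟙_ C

/-- A second, multiplicative, monoidal structure on a category. -/
class MulStructure (C : Type u) [Category.{v} C] where
  mon : MonoidalCategory C

section Multiplicative

variable {C : Type u} [Category.{v} C] [MulStructure C]

/-- The product of two objects. -/
def mulObj (r s : C) : C := MulStructure.mon.toMonoidalCategoryStruct.tensorObj r s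

/-- The product of two morphisms. -/
def mulHom {r r' s s' : C} (f : r ⟶ r') (g : s ⟶ s') : mulObj r s ⟶ mulObj r' s' :=
  MulStructure.mon.toMonoidalCategoryStruct.tensorHom f g

variable (C) in
/-- The multiplicative unit object. -/
def oneObj : C := (MulStructure.mon (C := C)).toMonoidalCategoryStruct.tensorUnit

/-- The multiplicative associativity constraint `(rs)t ≅ r(st)`. -/
def mulAssoc (r s t : C) : mulObj (mulObj r s) t ≅ mulObj r (mulObj s t) :=
  MulStructure.mon.toMonoidalCategoryStruct.associator r s t

/-- The multiplicative left unit constraint `1r ≅ r`. -/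
def oneMul (r : C) : mulObj (oneObj C) r ≅ r :=
  MulStructure.mon.toMonoidalCategoryStruct.leftUnitor r

/-- The multiplicative right unit constraint `r1 ≅ r`. -/
def mulOne (r : C) : mulObj r (oneObj C) ≅ r :=
  MulStructure.mon.toMonoidalCategoryStruct.rightUnitor r

end Multiplicative

infixr:75 " ⊙ " => mulObj
infixr:75 " ⊙ₘ " => mulHom

/-- A categorical ring: a symmetric categorical group with a second monoidal structure and natural
left and right distributivity constraints, subject to coherence.  (The underlying category is a
groupoid, so all constraints are isomorphisms.)  `tensorμ a b c d` is the canonical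
isomorphism `(a + b) + (c + d) ⟶ (a + c) + (b + d)`. -/
class CategoricalRing (C : Type u) [Groupoid.{v} C] [MonoidalCategory C] [SymmetricCategory C]
    [MulStructure C] extends CategoricalGroup C where
  /-- left distributivity -/
  ldis : ∀ r s₀ s₁ : C, r ⊙ (s₀ ⊗ s₁) ⟶ (r ⊙ s₀) ⊗ (r ⊙ s₁)
  /-- right distributivity -/
  rdis : ∀ r₀ r₁ s : C, (r₀ ⊗ r₁) ⊙ s ⟶ (r₀ ⊙ s) ⊗ (r₁ ⊙ s)
  ldis_natural : ∀ {r r' s₀ s₀' s₁ s₁' : C} (f : r ⟶ r') (g₀ : s₀ ⟶ s₀') (g₁ : s₁ ⟶ s₁'),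
    (f ⊙ₘ (g₀ ⊗ₘ g₁)) ≫ ldis r' s₀' s₁' = ldis r s₀ s₁ ≫ ((f ⊙ₘ g₀) ⊗ₘ (f ⊙ₘ g₁))
  rdis_natural : ∀ {r₀ r₀' r₁ r₁' s s' : C} (f₀ : r₀ ⟶ r₀') (f₁ : r₁ ⟶ r₁') (g : s ⟶ s'),
    ((f₀ ⊗ₘ f₁) ⊙ₘ g) ≫ rdis r₀' r₁' s' = rdis r₀ r₁ s ≫ ((f₀ ⊙ₘ g) ⊗ₘ (f₁ ⊙ₘ g))
  /-- `(rs)(t₀+t₁) ⟶ r(st₀) + r(st₁)` -/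
  ldis_assoc : ∀ r s t₀ t₁ : C,
    (mulAssoc r s (t₀ ⊗ t₁)).hom ≫ (𝟙 r ⊙ₘ ldis s t₀ t₁) ≫ ldis r (s ⊙ t₀) (s ⊙ t₁) =
      ldis (r ⊙ s) t₀ t₁ ≫ ((mulAssoc r s t₀).hom ⊗ₘ (mulAssoc r s t₁).hom)
  /-- `(r(s₀+s₁))t ⟶ r(s₀t) + r(s₁t)` -/
  ldis_rdis_assoc : ∀ r s₀ s₁ t : C,
    (ldis r s₀ s₁ ⊙ₘ 𝟙 t) ≫ rdis (r ⊙ s₀) (r ⊙ s₁) t ≫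
        ((mulAssoc r s₀ t).hom ⊗ₘ (mulAssoc r s₁ t).hom) =
      (mulAssoc r (s₀ ⊗ s₁) t).hom ≫ (𝟙 r ⊙ₘ rdis s₀ s₁ t) ≫ ldis r (s₀ ⊙ t) (s₁ ⊙ t)
  /-- `((r₀+r₁)s)t ⟶ r₀(st) + r₁(st)` -/
  rdis_assoc : ∀ r₀ r₁ s t : C,
    (rdis r₀ r₁ s ⊙ₘ 𝟙 t) ≫ rdis (r₀ ⊙ s) (r₁ ⊙ s) t ≫
        ((mulAssoc r₀ s t).hom ⊗ₘ (mulAssoc r₁ s t).hom) =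
      (mulAssoc (r₀ ⊗ r₁) s t).hom ≫ rdis r₀ r₁ (s ⊙ t)
  /-- `1(r₀+r₁) ⟶ r₀+r₁` -/
  ldis_one : ∀ r₀ r₁ : C,
    ldis (oneObj C) r₀ r₁ ≫ ((oneMul r₀).hom ⊗ₘ (oneMul r₁).hom) = (oneMul (r₀ ⊗ r₁)).hom
  /-- `(r₀+r₁)1 ⟶ r₀+r₁` -/
  rdis_one : ∀ r₀ r₁ : C,
    rdis r₀ r₁ (oneObj C) ≫ ((mulOne r₀).hom ⊗ₘ (mulOne r₁).hom) = (mulOne (r₀ ⊗ r₁)).hom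
  /-- `r((s₀₀+s₀₁)+(s₁₀+s₁₁)) ⟶ (rs₀₀+rs₁₀)+(rs₀₁+rs₁₁)` -/
  ldis_interchange : ∀ r s₀₀ s₀₁ s₁₀ s₁₁ : C,
    ldis r (s₀₀ ⊗ s₀₁) (s₁₀ ⊗ s₁₁) ≫ (ldis r s₀₀ s₀₁ ⊗ₘ ldis r s₁₀ s₁₁) ≫
        tensorμ (r ⊙ s₀₀) (r ⊙ s₀₁) (r ⊙ s₁₀) (r ⊙ s₁₁) =
      (𝟙 r ⊙ₘ tensorμ s₀₀ s₀₁ s₁₀ s₁₁) ≫ ldis r (s₀₀ ⊗ s₁₀) (s₀₁ ⊗ s₁₁) ≫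
        (ldis r s₀₀ s₁₀ ⊗ₘ ldis r s₀₁ s₁₁)
  /-- `(r₀+r₁)(s₀+s₁) ⟶ (r₀s₀+r₁s₀)+(r₀s₁+r₁s₁)` -/
  rdis_ldis_interchange : ∀ r₀ r₁ s₀ s₁ : C,
    rdis r₀ r₁ (s₀ ⊗ s₁) ≫ (ldis r₀ s₀ s₁ ⊗ₘ ldis r₁ s₀ s₁) ≫
        tensorμ (r₀ ⊙ s₀) (r₀ ⊙ s₁) (r₁ ⊙ s₀) (r₁ ⊙ s₁) =
      ldis (r₀ ⊗ r₁) s₀ s₁ ≫ (rdis r₀ r₁ s₀ ⊗ₘ rdis r₀ r₁ s₁)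
  /-- `((r₀₀+r₀₁)+(r₁₀+r₁₁))s ⟶ (r₀₀s+r₁₀s)+(r₀₁s+r₁₁s)` -/
  rdis_interchange : ∀ r₀₀ r₀₁ r₁₀ r₁₁ s : C,
    rdis (r₀₀ ⊗ r₀₁) (r₁₀ ⊗ r₁₁) s ≫ (rdis r₀₀ r₀₁ s ⊗ₘ rdis r₁₀ r₁₁ s) ≫
        tensorμ (r₀₀ ⊙ s) (r₀₁ ⊙ s) (r₁₀ ⊙ s) (r₁₁ ⊙ s) =
      (tensorμ r₀₀ r₀₁ r₁₀ r₁₁ ⊙ₘ 𝟙 s) ≫ rdis (r₀₀ ⊗ r₁₀) (r₀₁ ⊗ r₁₁) s ≫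
        (rdis r₀₀ r₁₀ s ⊗ₘ rdis r₀₁ r₁₁ s)
  /-- With `ldis`, the endofunctor `r · -` is a monoidal functor for the addition.  (The unit
  constraint `r0 ⟶ 0` of a monoidal functor between categorical groups, and its compatibility with
  the unit constraints, come for free.) -/
  ldis_add_assoc : ∀ r s₀ s₁ s₂ : C,
    ldis r (s₀ ⊗ s₁) s₂ ≫ (ldis r s₀ s₁ ⊗ₘ 𝟙 (r ⊙ s₂)) ≫ (α_ (r ⊙ s₀) (r ⊙ s₁) (r ⊙ s₂)).hom =
      (𝟙 r ⊙ₘ (α_ s₀ s₁ s₂).hom) ≫ ldis r s₀ (s₁ ⊗ s₂) ≫ (𝟙 (r ⊙ s₀) ⊗ₘ ldis r s₁ s₂)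
  /-- With `rdis`, the endofunctor `- · s` is a monoidal functor for the addition. -/
  rdis_add_assoc : ∀ r₀ r₁ r₂ s : C,
    rdis (r₀ ⊗ r₁) r₂ s ≫ (rdis r₀ r₁ s ⊗ₘ 𝟙 (r₂ ⊙ s)) ≫ (α_ (r₀ ⊙ s) (r₁ ⊙ s) (r₂ ⊙ s)).hom =
      ((α_ r₀ r₁ r₂).hom ⊙ₘ 𝟙 s) ≫ rdis r₀ (r₁ ⊗ r₂) s ≫ (𝟙 (r₀ ⊙ s) ⊗ₘ rdis r₁ r₂ s)

open CategoricalRing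

/-- A 2-homomorphism of categorical rings: a functor `F` with monoidal structures for the addition
and for the multiplication, compatible with both distributivity constraints.  (All categories are
groupoids, so a lax monoidal structure is a strong one: `ε` is the inverse of the
unit constraint `F 0 ⟶ 0`, resp. `F 1 ⟶ 1`.) -/
structure TwoHom (C : Type u) [Groupoid.{v} C] [MonoidalCategory C] [SymmetricCategory C]
    [MulStructure C] [CategoricalRing C]
    (D : Type u) [Groupoid.{v} D] [MonoidalCategory D] [SymmetricCategory D]
    [MulStructure D] [CategoricalRing D] where
  F : C ⥤ D
  addMonoidal : F.LaxMonoidal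
  mulMonoidal : @Functor.LaxMonoidal C _ MulStructure.mon D _ MulStructure.mon F
  /-- `F r (F s₀ + F s₁) ⟶ F (r s₀ + r s₁)` -/
  ldis_comp : ∀ r s₀ s₁ : C,
    ldis (F.obj r) (F.obj s₀) (F.obj s₁) ≫
        (mulMonoidal.μ r s₀ ⊗ₘ mulMonoidal.μ r s₁) ≫ addMonoidal.μ (r ⊙ s₀) (r ⊙ s₁) =
      (𝟙 (F.obj r) ⊙ₘ addMonoidal.μ s₀ s₁) ≫ mulMonoidal.μ r (s₀ ⊗ s₁) ≫ F.map (ldis r s₀ s₁)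
  /-- `(F r₀ + F r₁) F s ⟶ F (r₀ s + r₁ s)` -/
  rdis_comp : ∀ r₀ r₁ s : C,
    rdis (F.obj r₀) (F.obj r₁) (F.obj s) ≫
        (mulMonoidal.μ r₀ s ⊗ₘ mulMonoidal.μ r₁ s) ≫ addMonoidal.μ (r₀ ⊙ s) (r₁ ⊙ s) =
      (addMonoidal.μ r₀ r₁ ⊙ₘ 𝟙 (F.obj s)) ≫ mulMonoidal.μ (r₀ ⊗ r₁) s ≫ F.map (rdis r₀ r₁ s)

/-! ### Mac Lane cochains, cocycles and coboundaries -/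

/-- The cross-effect `f(x) + f(y) - f(x+y)`. -/
def crossEffect {A B : Type*} [Add A] [AddCommGroup B] (f : A → B) (x y : A) : B :=
  f x + f y - f (x + y)

section Cohomology

variable (R : Type u) [Ring R] (B : Type v) [AddCommGroup B]

/-- Quadruples `(φ_·, φ_{·+}, φ_{+·}, φ_+)` of maps `R³ → B`, `R³ → B`, `R³ → B`, `R⁴ → B`, with
valuewise addition.  The arguments of `φ_+` are the entries `r₀₀ r₀₁ r₁₀ r₁₁` of a `2 × 2`
matrix. -/
abbrev Quadruple : Type (max u v) :=
  (R → R → R → B) × (R → R → R → B) × (R → R → R → B) × (R → R → R → R → B)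

variable {R B}

namespace Quadruple

/-- `φ_·` -/
def m (φ : Quadruple R B) : R → R → R → B := φ.1
/-- `φ_{·+}` -/
def l (φ : Quadruple R B) : R → R → R → B := φ.2.1
/-- `φ_{+·}` -/
def r (φ : Quadruple R B) : R → R → R → B := φ.2.2.1
/-- `φ_+` -/
def a (φ : Quadruple R B) : R → R → R → R → B := φ.2.2.2

@[simp] lemma add_m (φ ψ : Quadruple R B) (x y z : R) : (φ + ψ).m x y z = φ.m x y z + ψ.m x y z := rfl
@[simp] lemma add_l (φ ψ : Quadruple R B) (x y z : R) : (φ + ψ).l x y z = φ.l x y z + ψ.l x y z := rfl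
@[simp] lemma add_r (φ ψ : Quadruple R B) (x y z : R) : (φ + ψ).r x y z = φ.r x y z + ψ.r x y z := rfl
@[simp] lemma add_a (φ ψ : Quadruple R B) (x y z w : R) :
    (φ + ψ).a x y z w = φ.a x y z w + ψ.a x y z w := rfl
@[simp] lemma neg_m (φ : Quadruple R B) (x y z : R) : (-φ).m x y z = -φ.m x y z := rfl
@[simp] lemma neg_l (φ : Quadruple R B) (x y z : R) : (-φ).l x y z = -φ.l x y z := rfl
@[simp] lemma neg_r (φ : Quadruple R B) (x y z : R) : (-φ).r x y z = -φ.r x y z := rfl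
@[simp] lemma neg_a (φ : Quadruple R B) (x y z w : R) : (-φ).a x y z w = -φ.a x y z w := rfl

/-- Normalized quadruples. -/
structure IsNormalized (φ : Quadruple R B) : Prop where
  m₁ : ∀ s t, φ.m 0 s t = 0
  m₂ : ∀ r t, φ.m r 0 t = 0
  m₃ : ∀ r s, φ.m r s 0 = 0
  l₁ : ∀ s₀ s₁, φ.l 0 s₀ s₁ = 0
  l₂ : ∀ r s₁, φ.l r 0 s₁ = 0
  l₃ : ∀ r s₀, φ.l r s₀ 0 = 0
  r₁ : ∀ r₁ s, φ.r 0 r₁ s = 0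
  r₂ : ∀ r₀ s, φ.r r₀ 0 s = 0
  r₃ : ∀ r₀ r₁, φ.r r₀ r₁ 0 = 0
  a₁ : ∀ r₀ r₁, φ.a r₀ r₁ 0 0 = 0
  a₂ : ∀ r₀ r₁, φ.a 0 0 r₀ r₁ = 0
  a₃ : ∀ r₀ r₁, φ.a r₀ 0 r₁ 0 = 0
  a₄ : ∀ r₀ r₁, φ.a 0 r₀ 0 r₁ = 0
  a₅ : ∀ r₀ r₁, φ.a r₀ 0 0 r₁ = 0

variable [Module R B] [Module Rᵐᵒᵖ B]

/-- The eight cocycle equations.  `b <• t` is the right action of `t : R` on `b : B`. -/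
structure IsCocycle (φ : Quadruple R B) : Prop where
  eq₁ : ∀ r s t u, r • φ.m s t u - φ.m (r * s) t u + φ.m r (s * t) u - φ.m r s (t * u)
    + φ.m r s t <• u = 0
  eq₂ : ∀ r s t₀ t₁, r • φ.l s t₀ t₁ - φ.l (r * s) t₀ t₁ + φ.l r (s * t₀) (s * t₁) =
    crossEffect (fun t => φ.m r s t) t₀ t₁
  eq₃ : ∀ r s₀ s₁ t, φ.l r (s₀ * t) (s₁ * t) - φ.l r s₀ s₁ <• t =
    φ.r (r * s₀) (r * s₁) t - r • φ.r s₀ s₁ t + crossEffect (fun s => φ.m r s t) s₀ s₁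
  eq₄ : ∀ r₀ r₁ s t, φ.r (r₀ * s) (r₁ * s) t - φ.r r₀ r₁ (s * t) + φ.r r₀ r₁ s <• t =
    - crossEffect (fun r => φ.m r s t) r₀ r₁
  eq₅ : ∀ r s₀₀ s₀₁ s₁₀ s₁₁,
    φ.a (r * s₀₀) (r * s₀₁) (r * s₁₀) (r * s₁₁) - r • φ.a s₀₀ s₀₁ s₁₀ s₁₁ =
      crossEffect (fun p : R × R => φ.l r p.1 p.2) (s₀₀, s₁₀) (s₀₁, s₁₁)
      - crossEffect (fun p : R × R => φ.l r p.1 p.2) (s₀₀, s₀₁) (s₁₀, s₁₁)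
  eq₆ : ∀ r₀ r₁ s₀ s₁, φ.a (r₀ * s₀) (r₀ * s₁) (r₁ * s₀) (r₁ * s₁) =
    crossEffect (fun s => φ.r r₀ r₁ s) s₀ s₁ - crossEffect (fun r => φ.l r s₀ s₁) r₀ r₁
  eq₇ : ∀ r₀₀ r₀₁ r₁₀ r₁₁ s,
    φ.a (r₀₀ * s) (r₀₁ * s) (r₁₀ * s) (r₁₁ * s) - φ.a r₀₀ r₀₁ r₁₀ r₁₁ <• s =
      crossEffect (fun p : R × R => φ.r p.1 p.2 s) (r₀₀, r₁₀) (r₀₁, r₁₁)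
      - crossEffect (fun p : R × R => φ.r p.1 p.2 s) (r₀₀, r₀₁) (r₁₀, r₁₁)
  eq₈ : ∀ r₀₀₀ r₀₀₁ r₀₁₀ r₀₁₁ r₁₀₀ r₁₀₁ r₁₁₀ r₁₁₁,
    crossEffect (fun q : R × R × R × R => φ.a q.1 q.2.1 q.2.2.1 q.2.2.2)
        (r₀₀₀, r₀₀₁, r₀₁₀, r₀₁₁) (r₁₀₀, r₁₀₁, r₁₁₀, r₁₁₁)
      - crossEffect (fun q : R × R × R × R => φ.a q.1 q.2.1 q.2.2.1 q.2.2.2)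
        (r₀₀₀, r₀₀₁, r₁₀₀, r₁₀₁) (r₀₁₀, r₀₁₁, r₁₁₀, r₁₁₁)
      + crossEffect (fun q : R × R × R × R => φ.a q.1 q.2.1 q.2.2.1 q.2.2.2)
        (r₀₀₀, r₀₁₀, r₁₀₀, r₁₁₀) (r₀₀₁, r₀₁₁, r₁₀₁, r₁₁₁) = 0

/-- `φ` is the coboundary of the pair of maps `γ_· = γm`, `γ_+ = γa`. -/
structure IsCoboundaryOf (φ : Quadruple R B) (γm γa : R → R → B) : Prop where
  m : ∀ r s t, φ.m r s t = r • γm s t - γm (r * s) t + γm r (s * t) - γm r s <• t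
  l : ∀ r s₀ s₁, φ.l r s₀ s₁ = r • γa s₀ s₁ - γa (r * s₀) (r * s₁)
    + crossEffect (fun s => γm r s) s₀ s₁
  r : ∀ r₀ r₁ s, φ.r r₀ r₁ s = γa r₀ r₁ <• s - γa (r₀ * s) (r₁ * s)
    + crossEffect (fun r => γm r s) r₀ r₁
  a : ∀ r₀₀ r₀₁ r₁₀ r₁₁, φ.a r₀₀ r₀₁ r₁₀ r₁₁ =
    crossEffect (fun p : R × R => γa p.1 p.2) (r₀₀, r₀₁) (r₁₀, r₁₁)
    - crossEffect (fun p : R × R => γa p.1 p.2) (r₀₀, r₁₀) (r₀₁, r₁₁)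

end Quadruple

open Quadruple

variable (R B)

/-- The group of Mac Lane 3-cochains: normalized quadruples. -/
def C3 : AddSubgroup (Quadruple R B) where
  carrier := {φ | φ.IsNormalized}
  zero_mem' := by constructor <;> intros <;> rfl
  add_mem' := by
    intro φ ψ hφ hψ
    constructor <;> intros <;>
      simp [hφ.m₁, hφ.m₂, hφ.m₃, hφ.l₁, hφ.l₂, hφ.l₃, hφ.r₁, hφ.r₂, hφ.r₃, hφ.a₁, hφ.a₂, hφ.a₃,
        hφ.a₄, hφ.a₅, hψ.m₁, hψ.m₂, hψ.m₃, hψ.l₁, hψ.l₂, hψ.l₃, hψ.r₁, hψ.r₂, hψ.r₃, hψ.a₁,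
        hψ.a₂, hψ.a₃, hψ.a₄, hψ.a₅]
  neg_mem' := by
    intro φ hφ
    constructor <;> intros <;>
      simp [hφ.m₁, hφ.m₂, hφ.m₃, hφ.l₁, hφ.l₂, hφ.l₃, hφ.r₁, hφ.r₂, hφ.r₃, hφ.a₁, hφ.a₂, hφ.a₃,
        hφ.a₄, hφ.a₅]

variable [Module R B] [Module Rᵐᵒᵖ B]

/-- The subgroup of 3-cocycles. -/
def Z3 : AddSubgroup (C3 R B) where
  carrier := {φ | φ.1.IsCocycle}
  zero_mem' := by
    constructor <;> intros <;> simp [crossEffect, Quadruple.m, Quadruple.l, Quadruple.r, Quadruple.a]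
  add_mem' := by
    intro φ ψ hφ hψ
    constructor
    · intro r s t u
      convert congrArg₂ (· + ·) (hφ.eq₁ r s t u) (hψ.eq₁ r s t u) using 1 <;> simp <;> abel
    · intro r s t u
      convert congrArg₂ (· + ·) (hφ.eq₂ r s t u) (hψ.eq₂ r s t u) using 1 <;>
        simp [crossEffect] <;> abel
    · intro r s t u
      convert congrArg₂ (· + ·) (hφ.eq₃ r s t u) (hψ.eq₃ r s t u) using 1 <;>
        simp [crossEffect] <;> abel
    · intro r s t u
      convert congrArg₂ (· + ·) (hφ.eq₄ r s t u) (hψ.eq₄ r s t u) using 1 <;>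
        simp [crossEffect] <;> abel
    · intro r s t u w
      convert congrArg₂ (· + ·) (hφ.eq₅ r s t u w) (hψ.eq₅ r s t u w) using 1 <;>
        simp [crossEffect] <;> abel
    · intro r s t u
      convert congrArg₂ (· + ·) (hφ.eq₆ r s t u) (hψ.eq₆ r s t u) using 1 <;>
        simp [crossEffect] <;> abel
    · intro r s t u w
      convert congrArg₂ (· + ·) (hφ.eq₇ r s t u w) (hψ.eq₇ r s t u w) using 1 <;>
        simp [crossEffect] <;> abel
    · intro a b c d e f g h
      convert congrArg₂ (· + ·) (hφ.eq₈ a b c d e f g h) (hψ.eq₈ a b c d e f g h) using 1 <;>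
        simp [crossEffect] <;> abel
  neg_mem' := by
    intro φ hφ
    constructor
    · intro r s t u
      convert congrArg (- ·) (hφ.eq₁ r s t u) using 1 <;> simp <;> abel
    · intro r s t u
      convert congrArg (- ·) (hφ.eq₂ r s t u) using 1 <;> simp [crossEffect] <;> abel
    · intro r s t u
      convert congrArg (- ·) (hφ.eq₃ r s t u) using 1 <;> simp [crossEffect] <;> abel
    · intro r s t u
      convert congrArg (- ·) (hφ.eq₄ r s t u) using 1 <;> simp [crossEffect] <;> abel
    · intro r s t u w
      convert congrArg (- ·) (hφ.eq₅ r s t u w) using 1 <;> simp [crossEffect] <;> abel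
    · intro r s t u
      convert congrArg (- ·) (hφ.eq₆ r s t u) using 1 <;> simp [crossEffect] <;> abel
    · intro r s t u w
      convert congrArg (- ·) (hφ.eq₇ r s t u w) using 1 <;> simp [crossEffect] <;> abel
    · intro a b c d e f g h
      convert congrArg (- ·) (hφ.eq₈ a b c d e f g h) using 1 <;>
        simp [crossEffect] <;> abel

/-- The subgroup of 3-coboundaries. -/
def B3 : AddSubgroup (C3 R B) where
  carrier := {φ | ∃ γm γa : R → R → B, φ.1.IsCoboundaryOf γm γa}
  zero_mem' := ⟨0, 0, by
    constructor <;> intros <;> simp [crossEffect, Quadruple.m, Quadruple.l, Quadruple.r, Quadruple.a]⟩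
  add_mem' := by
    rintro φ ψ ⟨γm, γa, h⟩ ⟨γm', γa', h'⟩
    refine ⟨γm + γm', γa + γa', ?_⟩
    constructor <;> intros <;>
      simp [crossEffect, h.m, h.l, h.r, h.a, h'.m, h'.l, h'.r, h'.a] <;> abel
  neg_mem' := by
    rintro φ ⟨γm, γa, h⟩
    refine ⟨-γm, -γa, ?_⟩
    constructor <;> intros <;> simp [crossEffect, h.m, h.l, h.r, h.a] <;> abel

/-- Every coboundary is a cocycle. -/
theorem B3_le_Z3 [SMulCommClass R Rᵐᵒᵖ B] : B3 R B ≤ Z3 R B := by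
  rintro φ ⟨γm, γa, h⟩
  constructor <;> intros <;>
    simp only [crossEffect, h.m, h.l, h.r, h.a, smul_add, smul_sub, mul_smul, MulOpposite.op_mul,
      mul_add, add_mul, add_smul, MulOpposite.op_add, mul_assoc, smul_comm (_ : R) (_ : Rᵐᵒᵖ) (_ : B), Prod.mk_add_mk,
      add_add_add_comm] <;> abel_nf

/-- The third Mac Lane cohomology group. -/
abbrev H3 : Type (max u v) := Z3 R B ⧸ (B3 R B).addSubgroupOf (Z3 R B)

end Cohomology

/-! ### Categorical rings with prescribed `π₀` and `π₁` -/

section Crext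

variable (R : Type u) [Ring R] (B : Type v) [AddCommGroup B] [Module R B] [Module Rᵐᵒᵖ B]
  [SMulCommClass R Rᵐᵒᵖ B]

/-- A categorical ring `C` with `π₀(C) = R`, `π₁(C) = B`: the ring of isomorphism classes of objects
is identified with `R`, the group of automorphisms of the zero object is identified with `B`, and
the bimodule structure that `C` induces on its `π₁` is the given one.  There, the class of `x` acts
on `β : 0 ⟶ 0` by `xβ : x0 ⟶ x0` and the canonical isomorphism `x0 ⟶ 0`; since the group
of automorphisms of `0` is abelian, every isomorphism `e : x0 ⟶ 0` transports `xβ` to the same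
automorphism of `0`. -/
structure CrossedExtension where
  C : Type u
  [groupoid : Groupoid.{v} C]
  [monoidal : MonoidalCategory C]
  [symmetric : SymmetricCategory C]
  [mulStructure : MulStructure C]
  [categoricalRing : CategoricalRing C]
  pi0 : Quotient (isIsomorphicSetoid C) ≃ R
  pi0_add : ∀ x y : C, pi0 ⟦x ⊗ y⟧ = pi0 ⟦x⟧ + pi0 ⟦y⟧
  pi0_mul : ∀ x y : C, pi0 ⟦x ⊙ y⟧ = pi0 ⟦x⟧ * pi0 ⟦y⟧
  pi0_one : pi0 ⟦oneObj C⟧ = 1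
  pi1 : (𝟙_ C ⟶ 𝟙_ C) ≃ B
  pi1_comp : ∀ β β' : 𝟙_ C ⟶ 𝟙_ C, pi1 (β ≫ β') = pi1 β + pi1 β'
  pi1_smul : ∀ (x : C) (β : 𝟙_ C ⟶ 𝟙_ C) (e : x ⊙ 𝟙_ C ⟶ 𝟙_ C),
    pi1 (inv e ≫ (𝟙 x ⊙ₘ β) ≫ e) = pi0 ⟦x⟧ • pi1 β
  pi1_op_smul : ∀ (x : C) (β : 𝟙_ C ⟶ 𝟙_ C) (e : 𝟙_ C ⊙ x ⟶ 𝟙_ C),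
    pi1 (inv e ≫ (β ⊙ₘ 𝟙 x) ≫ e) = pi1 β <• pi0 ⟦x⟧

attribute [instance] CrossedExtension.groupoid CrossedExtension.monoidal
  CrossedExtension.symmetric CrossedExtension.mulStructure CrossedExtension.categoricalRing

variable {R B}

/-- There is a 2-homomorphism `X ⟶ Y` that induces the identity on `π₀ = R` and on `π₁ = B`. -/
def CrossedExtension.Rel (X Y : CrossedExtension R B) : Prop :=
  ∃ f : TwoHom X.C Y.C,
    (∀ x : X.C, Y.pi0 ⟦f.F.obj x⟧ = X.pi0 ⟦x⟧) ∧
    (∀ β : 𝟙_ X.C ⟶ 𝟙_ X.C,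
      Y.pi1 (f.addMonoidal.ε ≫ f.F.map β ≫ inv f.addMonoidal.ε) = X.pi1 β)

variable (R B) in
/-- Equivalence classes of categorical rings with `π₀ = R` and `π₁ = B`. -/
def Crext : Type (max (u + 1) (v + 1)) := Quot (CrossedExtension.Rel (R := R) (B := B))

namespace CrossedExtension

/-- The morphism `f + b : x ⟶ y` for `f : x ⟶ y` and `b ∈ π₁`; every morphism `x ⟶ y` is `f + b`
for a unique `b`, its difference from `f`. -/
def shift (X : CrossedExtension R B) {x y : X.C} (f : x ⟶ y) (b : B) : x ⟶ y :=
  (ρ_ x).inv ≫ (f ⊗ₘ X.pi1.symm b) ≫ (ρ_ y).hom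

/-- `φ` is the cochain measuring, for some choice of an object `obj r` in each isomorphism class
`r ∈ R` and of morphisms `σm r s : obj r * obj s ⟶ obj (r * s)` and
`σa r s : obj r + obj s ⟶ obj (r + s)`, how far these are from being compatible with the
constraints of the categorical ring. -/
def IsCharacteristic (X : CrossedExtension R B) (φ : Quadruple R B) : Prop :=
  ∃ (obj : R → X.C) (_ : ∀ r, X.pi0 ⟦obj r⟧ = r)
    (σm : ∀ r s : R, obj r ⊙ obj s ⟶ obj (r * s))
    (σa : ∀ r s : R, obj r ⊗ obj s ⟶ obj (r + s)),
    (∀ r s t : R,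
      (mulAssoc (obj r) (obj s) (obj t)).hom ≫ (𝟙 (obj r) ⊙ₘ σm s t) ≫ σm r (s * t) =
        X.shift ((σm r s ⊙ₘ 𝟙 (obj t)) ≫ σm (r * s) t ≫
          eqToHom (congrArg obj (mul_assoc r s t))) (φ.m r s t)) ∧
    (∀ r s₀ s₁ : R,
      ldis (obj r) (obj s₀) (obj s₁) ≫ (σm r s₀ ⊗ₘ σm r s₁) ≫ σa (r * s₀) (r * s₁) =
        X.shift ((𝟙 (obj r) ⊙ₘ σa s₀ s₁) ≫ σm r (s₀ + s₁) ≫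
          eqToHom (congrArg obj (mul_add r s₀ s₁))) (φ.l r s₀ s₁)) ∧
    (∀ r₀ r₁ s : R,
      rdis (obj r₀) (obj r₁) (obj s) ≫ (σm r₀ s ⊗ₘ σm r₁ s) ≫ σa (r₀ * s) (r₁ * s) =
        X.shift ((σa r₀ r₁ ⊙ₘ 𝟙 (obj s)) ≫ σm (r₀ + r₁) s ≫
          eqToHom (congrArg obj (add_mul r₀ r₁ s))) (φ.r r₀ r₁ s)) ∧
    (∀ r₀₀ r₀₁ r₁₀ r₁₁ : R,
      tensorμ (obj r₀₀) (obj r₀₁) (obj r₁₀) (obj r₁₁) ≫ (σa r₀₀ r₁₀ ⊗ₘ σa r₀₁ r₁₁) ≫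
          σa (r₀₀ + r₁₀) (r₀₁ + r₁₁) =
        X.shift ((σa r₀₀ r₀₁ ⊗ₘ σa r₁₀ r₁₁) ≫ σa (r₀₀ + r₀₁) (r₁₀ + r₁₁) ≫
          eqToHom (congrArg obj (add_add_add_comm r₀₀ r₀₁ r₁₀ r₁₁))) (φ.a r₀₀ r₀₁ r₁₀ r₁₁))

end CrossedExtension

end Crext

/-! ### The skeletal categorical ring of a cocycle -/

section Skeletal

variable {R : Type u} [Ring R] {B : Type v} [AddCommGroup B] [Module R B] [Module Rᵐᵒᵖ B]
  [SMulCommClass R Rᵐᵒᵖ B]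

/-- The type of objects of the skeletal categorical ring of `φ`: the elements of `R`. -/
@[nolint unusedArguments]
def Skel (_φ : Z3 R B) : Type u := R

/-- A morphism `(b, r) : r ⟶ s` where `s = r`. -/
@[ext]
structure SkelHom (φ : Z3 R B) (r s : Skel φ) : Type v where
  val : B
  eq : r = s

namespace Skel

variable {φ : Z3 R B}

/-- The element of `R` that an object is. -/
def el (r : Skel φ) : R := r

instance : Groupoid.{v} (Skel φ) where
  Hom r s := SkelHom φ r s
  id _ := ⟨0, rfl⟩
  comp f g := ⟨f.val + g.val, f.eq.trans g.eq⟩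
  inv f := ⟨-f.val, f.eq.symm⟩
  id_comp _ := SkelHom.ext (zero_add _)
  comp_id _ := SkelHom.ext (add_zero _)
  assoc _ _ _ := SkelHom.ext (add_assoc _ _ _)
  inv_comp _ := SkelHom.ext (neg_add_cancel _)
  comp_inv _ := SkelHom.ext (add_neg_cancel _)

/-- The morphism `(b, r) : r ⟶ s` for elements `r = s` of `R`. -/
def homMk {r s : Skel φ} (b : B) (h : r.el = s.el) : r ⟶ s := ⟨b, h⟩

@[ext] lemma hom_ext {r s : Skel φ} {f g : r ⟶ s} (h : f.val = g.val) : f = g := SkelHom.ext h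

@[simp] lemma homMk_val {r s : Skel φ} (b : B) (h : r.el = s.el) : (homMk b h).val = b := rfl
@[simp] lemma id_val (r : Skel φ) : SkelHom.val (𝟙 r) = 0 := rfl
@[simp] lemma comp_val {r s t : Skel φ} (f : r ⟶ s) (g : s ⟶ t) :
    SkelHom.val (f ≫ g) = f.val + g.val := rfl

lemma el_eq {r s : Skel φ} (f : r ⟶ s) : r.el = s.el := f.eq

/-- The isomorphism `(b, r) : r ⟶ s` for elements `r = s` of `R`. -/
def isoMk {r s : Skel φ} (b : B) (h : r.el = s.el) : r ≅ s where
  hom := homMk b h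
  inv := homMk (-b) h.symm

@[simp] lemma isoMk_hom_val {r s : Skel φ} (b : B) (h : r.el = s.el) :
    (isoMk b h).hom.val = b := rfl
@[simp] lemma isoMk_inv_val {r s : Skel φ} (b : B) (h : r.el = s.el) :
    (isoMk b h).inv.val = -b := rfl

/-- The additive monoidal structure: addition of elements of `R`,
`(b₀, r₀) + (b₁, r₁) = (b₀ + b₁, r₀ + r₁)`. -/
instance : MonoidalCategoryStruct (Skel φ) where
  tensorObj r s := (r.el + s.el : R)
  whiskerLeft r _ _ f := homMk f.val (congrArg (fun x : R => r.el + x) (el_eq f))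
  whiskerRight f r := homMk f.val (congrArg (fun x : R => x + r.el) (el_eq f))
  tensorHom f g := homMk (f.val + g.val) (congrArg₂ (· + ·) (el_eq f) (el_eq g))
  tensorUnit := (0 : R)
  associator r s t := isoMk (φ.1.1.a r.el s.el 0 t.el) (add_assoc r.el s.el t.el)
  leftUnitor r := isoMk 0 (zero_add r.el)
  rightUnitor r := isoMk 0 (add_zero r.el)

@[simp] lemma el_add (r s : Skel φ) : (r ⊗ s).el = r.el + s.el := rfl
@[simp] lemma el_zero : (𝟙_ (Skel φ)).el = 0 := rfl
@[simp] lemma whiskerLeft_val (r : Skel φ) {s t : Skel φ} (f : s ⟶ t) : (r ◁ f).val = f.val := rfl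
@[simp] lemma whiskerRight_val (r : Skel φ) {s t : Skel φ} (f : s ⟶ t) : (f ▷ r).val = f.val := rfl
@[simp] lemma tensorHom_val {r r' s s' : Skel φ} (f : r ⟶ r') (g : s ⟶ s') :
    (f ⊗ₘ g).val = f.val + g.val := rfl
@[simp] lemma associator_hom_val (r s t : Skel φ) :
    (α_ r s t).hom.val = φ.1.1.a r.el s.el 0 t.el := rfl
@[simp] lemma associator_inv_val (r s t : Skel φ) :
    (α_ r s t).inv.val = - φ.1.1.a r.el s.el 0 t.el := rfl
@[simp] lemma leftUnitor_hom_val (r : Skel φ) : (λ_ r).hom.val = 0 := rfl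
@[simp] lemma rightUnitor_hom_val (r : Skel φ) : (ρ_ r).hom.val = 0 := rfl

instance : MonoidalCategory (Skel φ) where
  tensorHom_def f g := by ext; simp
  id_tensorHom_id _ _ := by ext; simp
  tensorHom_comp_tensorHom _ _ _ _ := by ext; simp; abel
  whiskerLeft_id _ _ := rfl
  id_whiskerRight _ _ := rfl
  associator_naturality f g h := by
    ext; simp [el_eq f, el_eq g, el_eq h]; abel
  leftUnitor_naturality f := by ext; simp
  rightUnitor_naturality f := by ext; simp
  pentagon w x y z := by
    ext
    have h := φ.2.eq₈ w.el x.el 0 y.el 0 0 0 z.el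
    simp [crossEffect, φ.1.2.a₁, φ.1.2.a₂, φ.1.2.a₃, φ.1.2.a₄, φ.1.2.a₅] at h
    simp
    linear_combination (norm := abel) h
  triangle x y := by
    ext; simp [φ.1.2.a₅]

/-- The symmetry constraint. -/
def symm (r s : Skel φ) : r ⊗ s ≅ s ⊗ r := isoMk (φ.1.1.a 0 r.el s.el 0) (add_comm r.el s.el)

@[simp] lemma symm_hom_val (r s : Skel φ) : (symm r s).hom.val = φ.1.1.a 0 r.el s.el 0 := rfl

instance : SymmetricCategory (Skel φ) where
  braiding := symm
  braiding_naturality_right x _ _ f := by ext; simp [el_eq f]; abel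
  braiding_naturality_left f x := by ext; simp [el_eq f]; abel
  hexagon_forward x y z := by
    ext
    have h := φ.2.eq₈ 0 x.el y.el 0 0 0 0 z.el
    have h' := φ.2.eq₈ 0 0 0 x.el y.el z.el 0 0
    simp [crossEffect, φ.1.2.a₁, φ.1.2.a₂, φ.1.2.a₃, φ.1.2.a₄, φ.1.2.a₅] at h h'
    simp
    linear_combination (norm := abel) -h - h'
  hexagon_reverse x y z := by
    ext
    have h := φ.2.eq₈ 0 x.el 0 y.el 0 0 z.el 0
    have h' := φ.2.eq₈ 0 x.el z.el 0 0 0 0 y.el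
    simp [crossEffect, φ.1.2.a₁, φ.1.2.a₂, φ.1.2.a₃, φ.1.2.a₄, φ.1.2.a₅] at h h'
    simp
    linear_combination (norm := abel) h - h'
  symmetry x y := by
    ext
    have h := φ.2.eq₈ 0 0 x.el 0 0 y.el 0 0
    simp [crossEffect, φ.1.2.a₁, φ.1.2.a₂, φ.1.2.a₃, φ.1.2.a₄, φ.1.2.a₅] at h
    simp
    linear_combination (norm := abel) -h

@[simp] lemma braiding_hom_val (r s : Skel φ) :
    (β_ r s).hom.val = φ.1.1.a 0 r.el s.el 0 := rfl

@[simp] lemma tensorμ_val (w x y z : Skel φ) :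
    (tensorμ w x y z).val = φ.1.1.a w.el x.el y.el z.el := by
  have h₁ := φ.2.eq₈ 0 x.el y.el 0 w.el 0 0 z.el
  have h₂ := φ.2.eq₈ 0 x.el 0 y.el w.el 0 0 z.el
  have h₃ := φ.2.eq₈ 0 y.el 0 x.el w.el 0 0 z.el
  simp [crossEffect, φ.1.2.a₁, φ.1.2.a₂, φ.1.2.a₃, φ.1.2.a₄, φ.1.2.a₅] at h₁ h₂ h₃
  simp [tensorμ]
  linear_combination (norm := abel_nf) h₁ - h₂ + h₃

/-- The multiplicative monoidal structure: multiplication of elements of `R`,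
`(b, r)(b', r') = (br' + rb', rr')`. -/
@[reducible] def mulStruct (φ : Z3 R B) : MonoidalCategoryStruct (Skel φ) where
  tensorObj r s := (r.el * s.el : R)
  whiskerLeft r _ _ f := homMk (r.el • f.val) (congrArg (fun x : R => r.el * x) (el_eq f))
  whiskerRight f r := homMk (f.val <• r.el) (congrArg (fun x : R => x * r.el) (el_eq f))
  tensorHom {r _ s _} f g :=
    homMk (f.val <• s.el + r.el • g.val) (congrArg₂ (fun x y : R => x * y) (el_eq f) (el_eq g))
  tensorUnit := (1 : R)
  associator r s t := isoMk (φ.1.1.m r.el s.el t.el) (mul_assoc r.el s.el t.el)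
  leftUnitor r := isoMk (-φ.1.1.m 1 1 r.el) (one_mul r.el)
  rightUnitor r := isoMk (φ.1.1.m r.el 1 1) (mul_one r.el)

/-- The multiplicative monoidal structure. -/
@[reducible] def mulMon (φ : Z3 R B) : MonoidalCategory (Skel φ) where
  __ := mulStruct φ
  tensorHom_def {r r' s s'} f g := by
    apply hom_ext
    change f.val <• s.el + r.el • g.val = f.val <• s.el + r'.el • g.val
    rw [el_eq f]
  id_tensorHom_id r s := by
    apply hom_ext
    change (0 : B) <• s.el + r.el • (0 : B) = 0
    simp
  tensorHom_comp_tensorHom {r r' r'' s s' s''} f g f' g' := by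
    apply hom_ext
    change (f.val <• s.el + r.el • g.val) + (f'.val <• s'.el + r'.el • g'.val) =
      (f.val + f'.val) <• s.el + r.el • (g.val + g'.val)
    rw [el_eq f, el_eq g, smul_add, smul_add]
    abel
  whiskerLeft_id r s := by
    apply hom_ext
    change r.el • (0 : B) = 0
    simp
  id_whiskerRight r s := by
    apply hom_ext
    change (0 : B) <• s.el = 0
    simp
  associator_naturality {r s t r' s' t'} f g h := by
    apply hom_ext
    change (f.val <• s.el + r.el • g.val) <• t.el + (r.el * s.el) • h.val +
        φ.1.1.m r'.el s'.el t'.el =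
      φ.1.1.m r.el s.el t.el +
        (f.val <• (s.el * t.el) + r.el • (g.val <• t.el + s.el • h.val))
    rw [el_eq f, el_eq g, el_eq h, smul_add, smul_add, mul_smul, MulOpposite.op_mul, mul_smul,
      smul_comm r'.el (MulOpposite.op t'.el)]
    abel
  leftUnitor_naturality {r s} f := by
    apply hom_ext
    change (1 : R) • f.val + -φ.1.1.m 1 1 s.el = -φ.1.1.m 1 1 r.el + f.val
    rw [el_eq f, one_smul]
    abel
  rightUnitor_naturality {r s} f := by
    apply hom_ext
    change f.val <• (1 : R) + φ.1.1.m s.el 1 1 = φ.1.1.m r.el 1 1 + f.val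
    rw [el_eq f, MulOpposite.op_one, one_smul]
    abel
  pentagon r s t w := by
    apply hom_ext
    change φ.1.1.m r.el s.el t.el <• w.el + (φ.1.1.m r.el (s.el * t.el) w.el +
        r.el • φ.1.1.m s.el t.el w.el) =
      φ.1.1.m (r.el * s.el) t.el w.el + φ.1.1.m r.el s.el (t.el * w.el)
    linear_combination (norm := abel) φ.2.eq₁ r.el s.el t.el w.el
  triangle r s := by
    apply hom_ext
    change φ.1.1.m r.el 1 s.el + r.el • (-φ.1.1.m 1 1 s.el) = φ.1.1.m r.el 1 1 <• s.el
    have h := φ.2.eq₁ r.el 1 1 s.el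
    rw [mul_one, mul_one, one_mul] at h
    rw [smul_neg]
    linear_combination (norm := abel) -h

instance : MulStructure (Skel φ) where
  mon := mulMon φ

@[simp] lemma el_mul (r s : Skel φ) : (r ⊙ s).el = r.el * s.el := rfl
@[simp] lemma el_one : (oneObj (Skel φ)).el = 1 := rfl
@[simp] lemma mulHom_val {r r' s s' : Skel φ} (f : r ⟶ r') (g : s ⟶ s') :
    (f ⊙ₘ g).val = f.val <• s.el + r.el • g.val := rfl
@[simp] lemma mulAssoc_hom_val (r s t : Skel φ) :
    (mulAssoc r s t).hom.val = φ.1.1.m r.el s.el t.el := rfl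
@[simp] lemma oneMul_hom_val (r : Skel φ) : (oneMul r).hom.val = -φ.1.1.m 1 1 r.el := rfl
@[simp] lemma mulOne_hom_val (r : Skel φ) : (mulOne r).hom.val = φ.1.1.m r.el 1 1 := rfl

/-- The left distributivity constraint. -/
def ldisHom (r s₀ s₁ : Skel φ) : r ⊙ (s₀ ⊗ s₁) ⟶ (r ⊙ s₀) ⊗ (r ⊙ s₁) :=
  homMk (φ.1.1.l r.el s₀.el s₁.el) (mul_add r.el s₀.el s₁.el)

/-- The right distributivity constraint. -/
def rdisHom (r₀ r₁ s : Skel φ) : (r₀ ⊗ r₁) ⊙ s ⟶ (r₀ ⊙ s) ⊗ (r₁ ⊙ s) :=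
  homMk (φ.1.1.r r₀.el r₁.el s.el) (add_mul r₀.el r₁.el s.el)

@[simp] lemma ldisHom_val (r s₀ s₁ : Skel φ) :
    (ldisHom r s₀ s₁).val = φ.1.1.l r.el s₀.el s₁.el := rfl
@[simp] lemma rdisHom_val (r₀ r₁ s : Skel φ) :
    (rdisHom r₀ r₁ s).val = φ.1.1.r r₀.el r₁.el s.el := rfl

instance : CategoricalRing (Skel φ) where
  neg r := (-r.el : R)
  negHom r := homMk 0 (neg_add_cancel r.el)
  ldis := ldisHom
  rdis := rdisHom
  ldis_natural f g₀ g₁ := by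
    ext; simp [el_eq f, el_eq g₀, el_eq g₁, add_smul]; abel
  rdis_natural f₀ f₁ g := by
    ext; simp [el_eq f₀, el_eq f₁, el_eq g, add_smul]; abel
  ldis_assoc r s t₀ t₁ := by
    ext
    have h := φ.2.eq₂ r.el s.el t₀.el t₁.el
    simp [crossEffect] at h ⊢
    linear_combination (norm := abel) h
  ldis_rdis_assoc r s₀ s₁ t := by
    ext
    have h := φ.2.eq₃ r.el s₀.el s₁.el t.el
    simp [crossEffect] at h ⊢
    linear_combination (norm := abel) -h
  rdis_assoc r₀ r₁ s t := by
    ext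
    have h := φ.2.eq₄ r₀.el r₁.el s.el t.el
    simp [crossEffect] at h ⊢
    linear_combination (norm := abel) h
  ldis_one r₀ r₁ := by
    ext
    have h := φ.2.eq₂ 1 1 r₀.el r₁.el
    simp [crossEffect] at h ⊢
    linear_combination (norm := abel) h
  rdis_one r₀ r₁ := by
    ext
    have h := φ.2.eq₄ r₀.el r₁.el 1 1
    simp [crossEffect] at h ⊢
    linear_combination (norm := abel) h
  ldis_interchange r a b c d := by
    ext
    have h := φ.2.eq₅ r.el a.el b.el c.el d.el
    simp [crossEffect] at h ⊢
    linear_combination (norm := abel) h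
  rdis_ldis_interchange a b c d := by
    ext
    have h := φ.2.eq₆ a.el b.el c.el d.el
    simp [crossEffect] at h ⊢
    linear_combination (norm := abel) h
  rdis_interchange a b c d r := by
    ext
    have h := φ.2.eq₇ a.el b.el c.el d.el r.el
    simp [crossEffect] at h ⊢
    linear_combination (norm := abel) h
  ldis_add_assoc r a b c := by
    ext
    have h := φ.2.eq₅ r.el a.el b.el 0 c.el
    simp [crossEffect, φ.1.2.l₂, φ.1.2.l₃] at h ⊢
    linear_combination (norm := abel) h
  rdis_add_assoc a b c r := by
    ext
    have h := φ.2.eq₇ a.el b.el 0 c.el r.el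
    simp [crossEffect, φ.1.2.r₁, φ.1.2.r₂] at h ⊢
    linear_combination (norm := abel) h

end Skel

/-- The skeletal categorical ring of a 3-cocycle `φ`: its objects are the elements of `R`, its
morphisms are the automorphisms `(b, r) : r ⟶ r` for `b ∈ B`, and its constraints are given by `φ`. -/
def skeletal (φ : Z3 R B) : CrossedExtension R B where
  C := Skel φ
  pi0 :=
    { toFun := Quotient.lift Skel.el (fun _ _ h => h.elim fun i => Skel.el_eq i.hom)
      invFun := fun r => Quotient.mk _ (show Skel φ from r)
      left_inv := fun q => by induction q using Quotient.inductionOn; rfl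
      right_inv := fun _ => rfl }
  pi0_add _ _ := rfl
  pi0_mul _ _ := rfl
  pi0_one := rfl
  pi1 :=
    { toFun := fun f => f.val
      invFun := fun b => Skel.homMk b rfl
      left_inv := fun _ => rfl
      right_inv := fun _ => rfl }
  pi1_comp _ _ := rfl
  pi1_smul x β e := by
    have h : (inv e).val = -e.val := by
      rw [← Groupoid.inv_eq_inv]; rfl
    change (inv e).val + ((0 : B) <• (0 : R) + x.el • β.val + e.val) = x.el • β.val
    rw [h, smul_zero]; abel
  pi1_op_smul x β e := by
    have h : (inv e).val = -e.val := by
      rw [← Groupoid.inv_eq_inv]; rfl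
    change (inv e).val + (β.val <• x.el + (0 : R) • (0 : B) + e.val) = β.val <• x.el
    rw [h, smul_zero]; abel

end Skeletal

/-!
Choose an object in every class and a morphism from every object to the chosen object of its class.
Comparing a morphism with the chosen ones gives its value in `B = π₁`: values add up under
composition, and `val (f + g)`, `val (f g)` are `val f + val g`, `(val f) s + r (val g)` up to the
variation of two functions `κ`, `ν` of pairs of objects.  Evaluating a coherence diagram of a
categorical ring in such a *valuation* turns it into an equation in `B`, and the equations obtained
in this way are the cocycle equations for the cochain of the values of the constraints, in which
`κ` and `ν` are added so that only the classes of the objects matter.  Changing `κ` and `ν` by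
functions on `R × R` changes this cochain by an arbitrary coboundary, and doing so is the same as
changing the morphisms `σ`: the characteristic cochains form exactly one class modulo coboundaries,
which the value of the unit constraints lets us normalize.

A 2-homomorphism inducing the identity on `π₀` and `π₁` pulls a valuation back to one with the same
cochain.  Conversely, if `X` and `Y` have valuations with the same cochain, the functor that chooses
an object of `Y` of the same class and preserves values is a 2-homomorphism.  As `φ` is the cochain
of a valuation of `R_φ`, this determines all equivalences.
-/

/-! ### Categorical groups -/

/-- If `y ⊗ x` is isomorphic to the unit, then tensoring with `y` undoes tensoring with `x`. -/
def tensorLeftCompTensorLeftIso {C : Type u} [Category.{v} C] [MonoidalCategory C] {x y : C}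
    (e : y ⊗ x ≅ 𝟙_ C) : tensorLeft x ⋙ tensorLeft y ≅ 𝟭 C :=
  (tensorLeftTensor y x).symm ≪≫ (tensoringLeft C).mapIso e ≪≫ leftUnitorNatIso C

section CategoricalGroup

variable {C : Type u} [Groupoid.{v} C] [MonoidalCategory C] [CategoricalGroup C]

open CategoricalGroup

instance tensorLeft_faithful (x : C) : (tensorLeft x).Faithful :=
  Functor.Faithful.of_comp_iso (tensorLeftCompTensorLeftIso (asIso (negHom x)))

instance tensorLeft_full (x : C) : (tensorLeft x).Full :=
  Functor.Full.of_comp_faithful_iso (tensorLeftCompTensorLeftIso (asIso (negHom x)))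

end CategoricalGroup

/-! ### The multiplicative monoidal structure -/

section MulStructure

variable {C : Type u} [Category.{v} C] [MulStructure C]

lemma id_mulHom_id (r s : C) : (𝟙 r ⊙ₘ 𝟙 s) = 𝟙 (r ⊙ s) :=
  let _ := MulStructure.mon (C := C); MonoidalCategory.id_tensorHom_id r s

lemma mulHom_comp_mulHom {r r' r'' s s' s'' : C} (f : r ⟶ r') (g : s ⟶ s') (f' : r' ⟶ r'')
    (g' : s' ⟶ s'') : (f ⊙ₘ g) ≫ (f' ⊙ₘ g') = (f ≫ f') ⊙ₘ (g ≫ g') :=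
  let _ := MulStructure.mon (C := C); MonoidalCategory.tensorHom_comp_tensorHom f g f' g'

lemma mulAssoc_natural {r r' s s' t t' : C} (f : r ⟶ r') (g : s ⟶ s') (h : t ⟶ t') :
    ((f ⊙ₘ g) ⊙ₘ h) ≫ (mulAssoc r' s' t').hom = (mulAssoc r s t).hom ≫ (f ⊙ₘ g ⊙ₘ h) :=
  let _ := MulStructure.mon (C := C); MonoidalCategory.associator_naturality f g h

lemma oneMul_natural {r s : C} (f : r ⟶ s) :
    (𝟙 (oneObj C) ⊙ₘ f) ≫ (oneMul s).hom = (oneMul r).hom ≫ f := by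
  let _ := MulStructure.mon (C := C)
  exact (congrArg (· ≫ _) (MonoidalCategory.id_tensorHom _ f)).trans
    (MonoidalCategory.leftUnitor_naturality f)

lemma mulOne_natural {r s : C} (f : r ⟶ s) :
    (f ⊙ₘ 𝟙 (oneObj C)) ≫ (mulOne s).hom = (mulOne r).hom ≫ f := by
  let _ := MulStructure.mon (C := C)
  exact (congrArg (· ≫ _) (MonoidalCategory.tensorHom_id f _)).trans
    (MonoidalCategory.rightUnitor_naturality f)

lemma mul_pentagon (r s t w : C) :
    ((mulAssoc r s t).hom ⊙ₘ 𝟙 w) ≫ (mulAssoc r (s ⊙ t) w).hom ≫ (𝟙 r ⊙ₘ (mulAssoc s t w).hom) =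
      (mulAssoc (r ⊙ s) t w).hom ≫ (mulAssoc r s (t ⊙ w)).hom := by
  let _ := MulStructure.mon (C := C)
  have h := MonoidalCategory.pentagon r s t w
  rw [← MonoidalCategory.tensorHom_id, ← MonoidalCategory.id_tensorHom] at h
  exact h

lemma mul_triangle (r s : C) :
    (mulAssoc r (oneObj C) s).hom ≫ (𝟙 r ⊙ₘ (oneMul s).hom) = ((mulOne r).hom ⊙ₘ 𝟙 s) := by
  let _ := MulStructure.mon (C := C)
  have h := MonoidalCategory.triangle r s
  rw [← MonoidalCategory.tensorHom_id, ← MonoidalCategory.id_tensorHom] at h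
  exact h

lemma oneMul_one : (oneMul (oneObj C)).hom = (mulOne (oneObj C)).hom :=
  let _ := MulStructure.mon (C := C); MonoidalCategory.unitors_equal

end MulStructure

section Quadruple

variable {R : Type u} {B : Type v}

lemma Quadruple.ext {φ ψ : Quadruple R B} (hm : ∀ r s t, φ.m r s t = ψ.m r s t)
    (hl : ∀ r s t, φ.l r s t = ψ.l r s t) (hr : ∀ r s t, φ.r r s t = ψ.r r s t)
    (ha : ∀ w x y z, φ.a w x y z = ψ.a w x y z) : φ = ψ :=
  Prod.ext (funext₃ hm) (Prod.ext (funext₃ hl) (Prod.ext (funext₃ hr)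
    (funext fun w => funext₃ (ha w))))

lemma Quadruple.IsCoboundaryOf.eq [Ring R] [AddCommGroup B] [Module R B] [Module Rᵐᵒᵖ B]
    {φ ψ : Quadruple R B} {γm γa : R → R → B} (hφ : φ.IsCoboundaryOf γm γa)
    (hψ : ψ.IsCoboundaryOf γm γa) : φ = ψ :=
  Quadruple.ext (fun r s t => (hφ.m r s t).trans (hψ.m r s t).symm)
    (fun r s t => (hφ.l r s t).trans (hψ.l r s t).symm)
    (fun r s t => (hφ.r r s t).trans (hψ.r r s t).symm)
    (fun w x y z => (hφ.a w x y z).trans (hψ.a w x y z).symm)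

end Quadruple

namespace CrossedExtension

variable {R : Type u} [Ring R] {B : Type v} [AddCommGroup B] [Module R B] [Module Rᵐᵒᵖ B]
  (X : CrossedExtension R B)

/-! ### The classes of objects -/

/-- The class of an object in `π₀ = R`. -/
def cls (x : X.C) : R := X.pi0 ⟦x⟧

lemma cls_tensor (x y : X.C) : X.cls (x ⊗ y) = X.cls x + X.cls y := X.pi0_add x y

lemma cls_mul (x y : X.C) : X.cls (x ⊙ y) = X.cls x * X.cls y := X.pi0_mul x y

lemma cls_one : X.cls (oneObj X.C) = 1 := X.pi0_one

variable {X} in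
lemma cls_eq {x y : X.C} (f : x ⟶ y) : X.cls x = X.cls y :=
  congrArg X.pi0 (Quotient.sound ⟨asIso f⟩)

lemma cls_unit : X.cls (𝟙_ X.C) = 0 := by
  simpa only [cls_tensor, add_eq_left] using cls_eq (λ_ (𝟙_ X.C)).hom

variable {X} in
lemma nonempty_hom {x y : X.C} (h : X.cls x = X.cls y) : Nonempty (x ⟶ y) :=
  (Quotient.exact (X.pi0.injective h)).map Iso.hom

/-- A chosen object of each class. -/
noncomputable def rep (r : R) : X.C := (X.pi0.symm r).out

@[simp] lemma cls_rep (r : R) : X.cls (X.rep r) = r := by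
  rw [cls, rep, Quotient.out_eq, Equiv.apply_symm_apply]

lemma cls_surjective : Function.Surjective X.cls := fun r => ⟨X.rep r, X.cls_rep r⟩

/-! ### The action of `π₁` on morphisms -/

lemma pi1_symm_add (b c : B) : X.pi1.symm (b + c) = X.pi1.symm b ≫ X.pi1.symm c := by
  rw [Equiv.symm_apply_eq, X.pi1_comp, Equiv.apply_symm_apply, Equiv.apply_symm_apply]

lemma pi1_symm_zero : X.pi1.symm 0 = 𝟙 _ := by
  rw [Equiv.symm_apply_eq, eq_comm]
  simpa only [Category.comp_id, left_eq_add] using X.pi1_comp (𝟙 _) (𝟙 _)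

/-- The automorphism `1 + b` of an object. -/
def aut (x : X.C) (b : B) : x ⟶ x := (ρ_ x).inv ≫ x ◁ X.pi1.symm b ≫ (ρ_ x).hom

lemma rightUnitor_aut (x : X.C) (b : B) :
    (ρ_ x).hom ≫ X.aut x b = x ◁ X.pi1.symm b ≫ (ρ_ x).hom := by
  simp only [aut, Iso.hom_inv_id_assoc]

lemma comp_aut {x y : X.C} (f : x ⟶ y) (b : B) : f ≫ X.aut y b = X.aut x b ≫ f := by
  simp only [aut, Category.assoc]
  rw [rightUnitor_inv_naturality_assoc, ← whisker_exchange_assoc, rightUnitor_naturality]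

lemma shift_eq {x y : X.C} (f : x ⟶ y) (b : B) : X.shift f b = f ≫ X.aut y b := by
  simp only [shift, aut, MonoidalCategory.tensorHom_def, Category.assoc]
  rw [rightUnitor_inv_naturality_assoc]

lemma aut_add (x : X.C) (b c : B) : X.aut x (b + c) = X.aut x b ≫ X.aut x c := by
  simp only [aut, pi1_symm_add, MonoidalCategory.whiskerLeft_comp, Category.assoc,
    Iso.hom_inv_id_assoc]

lemma aut_zero (x : X.C) : X.aut x 0 = 𝟙 x := by
  simp only [aut, pi1_symm_zero, MonoidalCategory.whiskerLeft_id, Category.id_comp,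
    Iso.inv_hom_id]

lemma aut_unit (b : B) : X.aut (𝟙_ X.C) b = X.pi1.symm b := by
  rw [← cancel_epi (ρ_ (𝟙_ X.C)).hom, rightUnitor_aut, ← unitors_equal, leftUnitor_naturality]

lemma aut_bijective (x : X.C) : Function.Bijective (X.aut x) := by
  constructor
  · intro b c h
    apply X.pi1.symm.injective
    apply (tensorLeft x).map_injective
    exact (cancel_mono _).1 ((cancel_epi _).1 h)
  · intro h
    obtain ⟨β, hβ : x ◁ β = _⟩ := (tensorLeft x).map_surjective ((ρ_ x).hom ≫ h ≫ (ρ_ x).inv)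
    refine ⟨X.pi1 β, ?_⟩
    simp only [aut, Equiv.symm_apply_apply, hβ, Category.assoc, Iso.inv_hom_id, Category.comp_id,
      Iso.inv_hom_id_assoc]

variable {X} in
/-- The difference `g - f ∈ π₁` of parallel morphisms. -/
noncomputable def diff {x y : X.C} (f g : x ⟶ y) : B :=
  ((X.aut_bijective y).2 (inv f ≫ g)).choose

variable {X} in
lemma comp_aut_diff {x y : X.C} (f g : x ⟶ y) : f ≫ X.aut y (diff f g) = g := by
  rw [diff, ((X.aut_bijective y).2 (inv f ≫ g)).choose_spec, IsIso.hom_inv_id_assoc]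

lemma diff_comp_aut {x y : X.C} (f : x ⟶ y) (b : B) : diff f (f ≫ X.aut y b) = b :=
  (X.aut_bijective y).1 ((cancel_epi f).1 (comp_aut_diff _ _))

lemma whiskerLeft_aut (x y : X.C) (b : B) : x ◁ X.aut y b = X.aut (x ⊗ y) b := by
  simp [aut]

lemma aut_whiskerRight (x y : X.C) (b : B) : X.aut x b ▷ y = X.aut (x ⊗ y) b := by
  rw [← cancel_mono (β_ x y).hom, BraidedCategory.braiding_naturality_left, whiskerLeft_aut,
    comp_aut]

lemma exists_mul_unit_hom (x y : X.C) : ∃ e : x ⊙ 𝟙_ X.C ⟶ 𝟙_ X.C,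
    (𝟙 x ⊙ₘ (ρ_ y).hom) = ldis x y (𝟙_ X.C) ≫ (x ⊙ y) ◁ e ≫ (ρ_ _).hom := by
  obtain ⟨e⟩ := nonempty_hom (x := x ⊙ 𝟙_ X.C) (y := 𝟙_ X.C) (by rw [cls_mul, cls_unit, mul_zero])
  let f := ldis x y (𝟙_ X.C) ≫ (x ⊙ y) ◁ e ≫ (ρ_ _).hom
  refine ⟨e ≫ X.pi1.symm (diff f (𝟙 x ⊙ₘ (ρ_ y).hom)), ?_⟩
  rw [MonoidalCategory.whiskerLeft_comp, Category.assoc, ← rightUnitor_aut]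
  simpa only [f, Category.assoc] using (comp_aut_diff f (𝟙 x ⊙ₘ (ρ_ y).hom)).symm

lemma exists_unit_mul_hom (x y : X.C) : ∃ e : 𝟙_ X.C ⊙ y ⟶ 𝟙_ X.C,
    ((ρ_ x).hom ⊙ₘ 𝟙 y) = rdis x (𝟙_ X.C) y ≫ (x ⊙ y) ◁ e ≫ (ρ_ _).hom := by
  obtain ⟨e⟩ := nonempty_hom (x := 𝟙_ X.C ⊙ y) (y := 𝟙_ X.C) (by rw [cls_mul, cls_unit, zero_mul])
  let f := rdis x (𝟙_ X.C) y ≫ (x ⊙ y) ◁ e ≫ (ρ_ _).hom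
  refine ⟨e ≫ X.pi1.symm (diff f ((ρ_ x).hom ⊙ₘ 𝟙 y)), ?_⟩
  rw [MonoidalCategory.whiskerLeft_comp, Category.assoc, ← rightUnitor_aut]
  simpa only [f, Category.assoc] using (comp_aut_diff f ((ρ_ x).hom ⊙ₘ 𝟙 y)).symm

lemma id_mulHom_aut (x y : X.C) (b : B) : (𝟙 x ⊙ₘ X.aut y b) = X.aut (x ⊙ y) (X.cls x • b) := by
  obtain ⟨e, he⟩ := X.exists_mul_unit_hom x y
  have action : (𝟙 x ⊙ₘ X.pi1.symm b) ≫ e = e ≫ X.pi1.symm (X.cls x • b) := by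
    rw [cls, ← IsIso.inv_comp_eq e, Equiv.eq_symm_apply, X.pi1_smul, Equiv.apply_symm_apply]
  have natural := ldis_natural (𝟙 x) (𝟙 y) (X.pi1.symm b)
  rw [id_mulHom_id, id_tensorHom, id_tensorHom] at natural
  rw [← cancel_epi (𝟙 x ⊙ₘ (ρ_ y).hom), mulHom_comp_mulHom, rightUnitor_aut,
    ← mulHom_comp_mulHom (𝟙 x) _ (𝟙 x), he, reassoc_of% natural,
    ← MonoidalCategory.whiskerLeft_comp_assoc, action, MonoidalCategory.whiskerLeft_comp_assoc,
    Category.assoc, Category.assoc, rightUnitor_aut]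

lemma aut_mulHom_id (x y : X.C) (b : B) :
    (X.aut x b ⊙ₘ 𝟙 y) = X.aut (x ⊙ y) (b <• X.cls y) := by
  obtain ⟨e, he⟩ := X.exists_unit_mul_hom x y
  have action : (X.pi1.symm b ⊙ₘ 𝟙 y) ≫ e = e ≫ X.pi1.symm (b <• X.cls y) := by
    rw [cls, ← IsIso.inv_comp_eq e, Equiv.eq_symm_apply, X.pi1_op_smul, Equiv.apply_symm_apply]
  have natural := rdis_natural (𝟙 x) (X.pi1.symm b) (𝟙 y)
  rw [id_mulHom_id, id_tensorHom, id_tensorHom] at natural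
  rw [← cancel_epi ((ρ_ x).hom ⊙ₘ 𝟙 y), mulHom_comp_mulHom, rightUnitor_aut,
    ← mulHom_comp_mulHom _ (𝟙 y) _ (𝟙 y), he, reassoc_of% natural,
    ← MonoidalCategory.whiskerLeft_comp_assoc, action, MonoidalCategory.whiskerLeft_comp_assoc,
    Category.assoc, Category.assoc, rightUnitor_aut]

lemma comp_aut_tensorHom_comp_aut {x x' y y' : X.C} (f : x ⟶ x') (g : y ⟶ y') (b c : B) :
    (f ≫ X.aut x' b) ⊗ₘ (g ≫ X.aut y' c) = (f ⊗ₘ g) ≫ X.aut (x' ⊗ y') (b + c) := by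
  rw [← tensorHom_comp_tensorHom, MonoidalCategory.tensorHom_def (X.aut _ _), aut_whiskerRight,
    whiskerLeft_aut, aut_add]

lemma comp_aut_mulHom_comp_aut {x x' y y' : X.C} (f : x ⟶ x') (g : y ⟶ y') (b c : B) :
    ((f ≫ X.aut x' b) ⊙ₘ (g ≫ X.aut y' c)) =
      (f ⊙ₘ g) ≫ X.aut (x' ⊙ y') (b <• X.cls y' + X.cls x' • c) := by
  rw [aut_add, ← aut_mulHom_id, ← id_mulHom_aut, mulHom_comp_mulHom, mulHom_comp_mulHom,
    Category.id_comp, Category.comp_id]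

/-! ### Valuations -/

/-- A valuation assigns an element of `π₁ = B` to every morphism, compatibly with composition, and
compatibly with addition and multiplication up to given functions of pairs of objects.  It replaces
the choice of representing objects and of the morphisms `σ` in the definition of characteristic
cochains. -/
structure Valuation where
  val : ∀ {x y : X.C}, (x ⟶ y) → B
  κ : X.C → X.C → B
  ν : X.C → X.C → B
  val_comp : ∀ {x y z : X.C} (f : x ⟶ y) (g : y ⟶ z), val (f ≫ g) = val f + val g
  val_unit : ∀ β : 𝟙_ X.C ⟶ 𝟙_ X.C, val β = X.pi1 β
  val_tensorHom : ∀ {x x' y y' : X.C} (f : x ⟶ x') (g : y ⟶ y'),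
    val (f ⊗ₘ g) = val f + val g + κ x' y' - κ x y
  val_mulHom : ∀ {x x' y y' : X.C} (f : x ⟶ x') (g : y ⟶ y'),
    val (f ⊙ₘ g) = val f <• X.cls y + X.cls x • val g + ν x' y' - ν x y

section RepVal

variable {X}

/-- A chosen morphism from an object to the chosen object of its class. -/
noncomputable def toRep (x : X.C) : x ⟶ X.rep (X.cls x) := (nonempty_hom (X.cls_rep _).symm).some

/-- The identification of the chosen objects of the classes of source and target. -/
noncomputable def repHom {x y : X.C} (f : x ⟶ y) : X.rep (X.cls x) ⟶ X.rep (X.cls y) :=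
  eqToHom (congrArg X.rep (cls_eq f))

/-- The value of a morphism relative to the chosen objects and the chosen morphisms to them. -/
noncomputable def repVal {x y : X.C} (f : x ⟶ y) : B := diff (toRep x ≫ repHom f) (f ≫ toRep y)

lemma comp_toRep {x y : X.C} (f : x ⟶ y) :
    f ≫ toRep y = toRep x ≫ repHom f ≫ X.aut _ (repVal f) := by
  rw [← Category.assoc, repVal, comp_aut_diff]

lemma repVal_eq {x y : X.C} {f : x ⟶ y} {b : B} (h : f ≫ toRep y = toRep x ≫ repHom f ≫ X.aut _ b) :
    repVal f = b := by
  rw [repVal, h, ← Category.assoc, diff_comp_aut]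

lemma repVal_comp {x y z : X.C} (f : x ⟶ y) (g : y ⟶ z) :
    repVal (f ≫ g) = repVal f + repVal g := by
  apply repVal_eq
  have h : repHom (f ≫ g) = repHom f ≫ repHom g := (eqToHom_trans _ _).symm
  rw [Category.assoc, comp_toRep g, reassoc_of% comp_toRep f, aut_add, h, Category.assoc,
    reassoc_of% X.comp_aut (repHom g) (repVal f)]

lemma repVal_aut (x : X.C) (b : B) : repVal (X.aut x b) = b := by
  apply repVal_eq
  rw [← comp_aut, repHom, eqToHom_refl, Category.id_comp]

lemma repVal_id (x : X.C) : repVal (𝟙 x) = 0 := by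
  rw [← X.aut_zero, repVal_aut]

lemma repVal_repHom_tensorHom_repHom {x x' y y' : X.C} (f : x ⟶ x') (g : y ⟶ y') :
    repVal (repHom f ⊗ₘ repHom g) = 0 := by
  have h : ∀ {r r' s s' : R} (h : r = r') (h' : s = s'),
      repVal (eqToHom (congrArg X.rep h) ⊗ₘ eqToHom (congrArg X.rep h')) = 0 := by
    rintro r - s - rfl rfl
    rw [eqToHom_refl, eqToHom_refl, id_tensorHom_id, repVal_id]
  exact h (cls_eq f) (cls_eq g)

lemma repVal_repHom_mulHom_repHom {x x' y y' : X.C} (f : x ⟶ x') (g : y ⟶ y') :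
    repVal (repHom f ⊙ₘ repHom g) = 0 := by
  have h : ∀ {r r' s s' : R} (h : r = r') (h' : s = s'),
      repVal (eqToHom (congrArg X.rep h) ⊙ₘ eqToHom (congrArg X.rep h')) = 0 := by
    rintro r - s - rfl rfl
    rw [eqToHom_refl, eqToHom_refl, id_mulHom_id, repVal_id]
  exact h (cls_eq f) (cls_eq g)

lemma repVal_tensorHom {x x' y y' : X.C} (f : x ⟶ x') (g : y ⟶ y') :
    repVal (f ⊗ₘ g) + repVal (toRep x' ⊗ₘ toRep y') =
      repVal (toRep x ⊗ₘ toRep y) + (repVal f + repVal g) := by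
  rw [← repVal_comp, tensorHom_comp_tensorHom, comp_toRep f, comp_toRep g,
    ← tensorHom_comp_tensorHom, comp_aut_tensorHom_comp_aut, repVal_comp, repVal_comp, repVal_aut,
    repVal_repHom_tensorHom_repHom, zero_add]

lemma repVal_mulHom {x x' y y' : X.C} (f : x ⟶ x') (g : y ⟶ y') :
    repVal (f ⊙ₘ g) + repVal (toRep x' ⊙ₘ toRep y') =
      repVal (toRep x ⊙ₘ toRep y) + (repVal f <• X.cls y + X.cls x • repVal g) := by
  rw [← repVal_comp, mulHom_comp_mulHom, comp_toRep f, comp_toRep g, ← mulHom_comp_mulHom,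
    comp_aut_mulHom_comp_aut, repVal_comp, repVal_comp, repVal_aut, repVal_repHom_mulHom_repHom,
    zero_add, cls_rep, cls_rep, ← cls_eq f, ← cls_eq g]

end RepVal

/-- The valuation given by the chosen objects and the chosen morphisms to them. -/
noncomputable def repValuation : X.Valuation where
  val := repVal
  κ x y := -repVal (toRep x ⊗ₘ toRep y)
  ν x y := -repVal (toRep x ⊙ₘ toRep y)
  val_comp := repVal_comp
  val_unit β := by
    conv_lhs => rw [← X.pi1.symm_apply_apply β, ← aut_unit]
    exact repVal_aut _ _
  val_tensorHom f g := by linear_combination (norm := abel) repVal_tensorHom f g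
  val_mulHom f g := by linear_combination (norm := abel) repVal_mulHom f g

namespace Valuation

variable {X} (V : X.Valuation)

@[simp] lemma val_id (x : X.C) : V.val (𝟙 x) = 0 := by
  simpa only [Category.comp_id, left_eq_add] using V.val_comp (𝟙 x) (𝟙 x)

@[simp] lemma val_inv {x y : X.C} (f : x ⟶ y) [IsIso f] : V.val (inv f) = -V.val f := by
  rw [eq_neg_iff_add_eq_zero, ← V.val_comp, IsIso.inv_hom_id, val_id]

@[simp] lemma val_iso_inv {x y : X.C} (i : x ≅ y) : V.val i.inv = -V.val i.hom := by
  rw [← V.val_inv, IsIso.Iso.inv_hom]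

@[simp] lemma val_eqToHom {x y : X.C} (h : x = y) : V.val (eqToHom h) = 0 := by
  subst h
  exact V.val_id x

@[simp] lemma val_whiskerLeft (x : X.C) {y y' : X.C} (g : y ⟶ y') :
    V.val (x ◁ g) = V.val g + V.κ x y' - V.κ x y := by
  rw [← id_tensorHom, val_tensorHom, val_id, zero_add]

@[simp] lemma val_whiskerRight {x x' : X.C} (f : x ⟶ x') (y : X.C) :
    V.val (f ▷ y) = V.val f + V.κ x' y - V.κ x y := by
  rw [← tensorHom_id, val_tensorHom, val_id, add_zero]

@[simp] lemma val_aut (x : X.C) (b : B) : V.val (X.aut x b) = b := by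
  simp [aut, V.val_comp, V.val_unit]

@[simp] lemma val_shift {x y : X.C} (f : x ⟶ y) (b : B) : V.val (X.shift f b) = V.val f + b := by
  rw [shift_eq, V.val_comp, val_aut]

lemma val_injective {x y : X.C} : Function.Injective (V.val (x := x) (y := y)) := fun f g h => by
  rw [← comp_aut_diff f g, V.val_comp, val_aut, left_eq_add] at h
  rw [← comp_aut_diff f g, h, aut_zero, Category.comp_id]

lemma exists_val_eq {x y : X.C} (h : X.cls x = X.cls y) (b : B) : ∃ f : x ⟶ y, V.val f = b := by
  obtain ⟨f⟩ := nonempty_hom h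
  exact ⟨f ≫ X.aut y (b - V.val f), by rw [V.val_comp, val_aut, add_sub_cancel]⟩

/-- The morphism of given value between objects of the same class. -/
noncomputable def homOf {x y : X.C} (h : X.cls x = X.cls y) (b : B) : x ⟶ y :=
  (V.exists_val_eq h b).choose

@[simp] lemma val_homOf {x y : X.C} (h : X.cls x = X.cls y) (b : B) : V.val (V.homOf h b) = b :=
  (V.exists_val_eq h b).choose_spec

/-! ### Defects of the constraints -/

/-- The value of the additive associativity constraint, corrected by `κ` so that it only depends on
the classes of the objects. -/
noncomputable def addAssocDefect (r s t : R) : B :=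
  V.κ (X.rep r) (X.rep s) + V.κ (X.rep r ⊗ X.rep s) (X.rep t)
    + V.val (α_ (X.rep r) (X.rep s) (X.rep t)).hom
    - V.κ (X.rep s) (X.rep t) - V.κ (X.rep r) (X.rep s ⊗ X.rep t)

lemma addAssocDefect_cls (x y z : X.C) : V.addAssocDefect (X.cls x) (X.cls y) (X.cls z) =
    V.κ x y + V.κ (x ⊗ y) z + V.val (α_ x y z).hom - V.κ y z - V.κ x (y ⊗ z) := by
  have h := congrArg V.val (associator_naturality (toRep x) (toRep y) (toRep z))
  simp only [V.val_comp, V.val_tensorHom] at h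
  rw [addAssocDefect]
  linear_combination (norm := abel) h

/-- The corrected value of the additive symmetry. -/
noncomputable def addSymmDefect (r s : R) : B :=
  V.κ (X.rep r) (X.rep s) + V.val (β_ (X.rep r) (X.rep s)).hom - V.κ (X.rep s) (X.rep r)

lemma addSymmDefect_cls (x y : X.C) : V.addSymmDefect (X.cls x) (X.cls y) =
    V.κ x y + V.val (β_ x y).hom - V.κ y x := by
  have h := congrArg V.val (BraidedCategory.braiding_naturality (toRep x) (toRep y))
  simp only [V.val_comp, V.val_tensorHom] at h
  rw [addSymmDefect]
  linear_combination (norm := abel) h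

/-- The corrected value of the additive left unit constraint. -/
noncomputable def addLeftUnitDefect (r : R) : B :=
  V.κ (𝟙_ X.C) (X.rep r) + V.val (λ_ (X.rep r)).hom

lemma addLeftUnitDefect_cls (x : X.C) :
    V.addLeftUnitDefect (X.cls x) = V.κ (𝟙_ X.C) x + V.val (λ_ x).hom := by
  have h := congrArg V.val (leftUnitor_naturality (toRep x))
  simp only [V.val_comp, V.val_whiskerLeft] at h
  rw [addLeftUnitDefect]
  linear_combination (norm := abel) h

/-- The corrected value of the additive right unit constraint. -/
noncomputable def addRightUnitDefect (r : R) : B :=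
  V.κ (X.rep r) (𝟙_ X.C) + V.val (ρ_ (X.rep r)).hom

lemma addRightUnitDefect_cls (x : X.C) :
    V.addRightUnitDefect (X.cls x) = V.κ x (𝟙_ X.C) + V.val (ρ_ x).hom := by
  have h := congrArg V.val (rightUnitor_naturality (toRep x))
  simp only [V.val_comp, V.val_whiskerRight] at h
  rw [addRightUnitDefect]
  linear_combination (norm := abel) h

/-- The corrected value of the multiplicative left unit constraint. -/
noncomputable def mulLeftUnitDefect (r : R) : B :=
  V.ν (oneObj X.C) (X.rep r) + V.val (oneMul (X.rep r)).hom

lemma mulLeftUnitDefect_cls (x : X.C) :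
    V.mulLeftUnitDefect (X.cls x) = V.ν (oneObj X.C) x + V.val (oneMul x).hom := by
  have h := congrArg V.val (oneMul_natural (toRep x))
  simp only [V.val_comp, V.val_mulHom, val_id, smul_zero, X.cls_one, one_smul] at h
  rw [mulLeftUnitDefect]
  linear_combination (norm := abel) h

/-- The corrected value of the multiplicative right unit constraint. -/
noncomputable def mulRightUnitDefect (r : R) : B :=
  V.ν (X.rep r) (oneObj X.C) + V.val (mulOne (X.rep r)).hom

lemma mulRightUnitDefect_cls (x : X.C) :
    V.mulRightUnitDefect (X.cls x) = V.ν x (oneObj X.C) + V.val (mulOne x).hom := by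
  have h := congrArg V.val (mulOne_natural (toRep x))
  simp only [V.val_comp, V.val_mulHom, val_id, smul_zero, X.cls_one, one_smul,
    MulOpposite.op_one] at h
  rw [mulRightUnitDefect]
  linear_combination (norm := abel) h

/-- The corrected value of the multiplicative associativity constraint. -/
noncomputable def mulAssocDefect (r s t : R) : B :=
  V.ν (X.rep r) (X.rep s) <• t + V.ν (X.rep r ⊙ X.rep s) (X.rep t)
    + V.val (mulAssoc (X.rep r) (X.rep s) (X.rep t)).hom
    - r • V.ν (X.rep s) (X.rep t) - V.ν (X.rep r) (X.rep s ⊙ X.rep t)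

lemma mulAssocDefect_cls [SMulCommClass R Rᵐᵒᵖ B] (x y z : X.C) :
    V.mulAssocDefect (X.cls x) (X.cls y) (X.cls z) =
      V.ν x y <• X.cls z + V.ν (x ⊙ y) z + V.val (mulAssoc x y z).hom
        - X.cls x • V.ν y z - V.ν x (y ⊙ z) := by
  have h := congrArg V.val (mulAssoc_natural (toRep x) (toRep y) (toRep z))
  simp only [V.val_comp, V.val_mulHom, X.cls_mul, smul_add, smul_sub, mul_smul, MulOpposite.op_mul,
    smul_comm (_ : R) (_ : Rᵐᵒᵖ) (_ : B)] at h
  rw [mulAssocDefect]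
  linear_combination (norm := abel) h

/-- The corrected value of the left distributivity constraint. -/
noncomputable def leftDistribDefect (r s₀ s₁ : R) : B :=
  r • V.κ (X.rep s₀) (X.rep s₁) + V.ν (X.rep r) (X.rep s₀ ⊗ X.rep s₁)
    + V.val (ldis (X.rep r) (X.rep s₀) (X.rep s₁))
    - V.ν (X.rep r) (X.rep s₀) - V.ν (X.rep r) (X.rep s₁)
    - V.κ (X.rep r ⊙ X.rep s₀) (X.rep r ⊙ X.rep s₁)

lemma leftDistribDefect_cls (x y z : X.C) :
    V.leftDistribDefect (X.cls x) (X.cls y) (X.cls z) =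
      X.cls x • V.κ y z + V.ν x (y ⊗ z) + V.val (ldis x y z) - V.ν x y - V.ν x z
        - V.κ (x ⊙ y) (x ⊙ z) := by
  have h := congrArg V.val (ldis_natural (toRep x) (toRep y) (toRep z))
  simp only [V.val_comp, V.val_mulHom, V.val_tensorHom, X.cls_tensor, smul_add, smul_sub,
    add_smul, MulOpposite.op_add] at h
  rw [leftDistribDefect]
  linear_combination (norm := abel) h

/-- The corrected value of the right distributivity constraint. -/
noncomputable def rightDistribDefect (r₀ r₁ s : R) : B :=
  V.κ (X.rep r₀) (X.rep r₁) <• s + V.ν (X.rep r₀ ⊗ X.rep r₁) (X.rep s)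
    + V.val (rdis (X.rep r₀) (X.rep r₁) (X.rep s))
    - V.ν (X.rep r₀) (X.rep s) - V.ν (X.rep r₁) (X.rep s)
    - V.κ (X.rep r₀ ⊙ X.rep s) (X.rep r₁ ⊙ X.rep s)

lemma rightDistribDefect_cls (x y z : X.C) :
    V.rightDistribDefect (X.cls x) (X.cls y) (X.cls z) =
      V.κ x y <• X.cls z + V.ν (x ⊗ y) z + V.val (rdis x y z) - V.ν x z - V.ν y z
        - V.κ (x ⊙ z) (y ⊙ z) := by
  have h := congrArg V.val (rdis_natural (toRep x) (toRep y) (toRep z))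
  simp only [V.val_comp, V.val_mulHom, V.val_tensorHom, X.cls_tensor, smul_add, smul_sub,
    add_smul] at h
  rw [rightDistribDefect]
  linear_combination (norm := abel) h

/-- The corrected value of the interchange isomorphism `(w + x) + (y + z) ⟶ (w + y) + (x + z)`,
expressed by those of the constraints from which it is composed. -/
noncomputable def interchangeDefect (w x y z : R) : B :=
  V.addAssocDefect w x (y + z) - V.addAssocDefect x y z + V.addSymmDefect x y
    + V.addAssocDefect y x z - V.addAssocDefect w y (x + z)

lemma interchangeDefect_eq (w x y z : R) : V.interchangeDefect w x y z =
    V.addAssocDefect w x (y + z) - V.addAssocDefect x y z + V.addSymmDefect x y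
      + V.addAssocDefect y x z - V.addAssocDefect w y (x + z) := rfl

lemma interchangeDefect_cls (w x y z : X.C) :
    V.interchangeDefect (X.cls w) (X.cls x) (X.cls y) (X.cls z) =
      V.κ w x + V.κ y z + V.κ (w ⊗ x) (y ⊗ z) + V.val (tensorμ w x y z)
        - V.κ w y - V.κ x z - V.κ (w ⊗ y) (x ⊗ z) := by
  simp only [interchangeDefect_eq, tensorμ, V.val_comp, val_whiskerLeft, val_whiskerRight,
    val_iso_inv, ← X.cls_tensor, addAssocDefect_cls, addSymmDefect_cls]
  abel

/-- The cochain of a valuation, formed by the defects of the constraints. -/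
noncomputable def cochain : Quadruple R B :=
  (V.mulAssocDefect, V.leftDistribDefect, V.rightDistribDefect, V.interchangeDefect)

@[simp] lemma cochain_m (r s t : R) : V.cochain.m r s t = V.mulAssocDefect r s t := rfl

@[simp] lemma cochain_l (r s₀ s₁ : R) : V.cochain.l r s₀ s₁ = V.leftDistribDefect r s₀ s₁ := rfl

@[simp] lemma cochain_r (r₀ r₁ s : R) : V.cochain.r r₀ r₁ s = V.rightDistribDefect r₀ r₁ s := rfl

@[simp] lemma cochain_a (w x y z : R) : V.cochain.a w x y z = V.interchangeDefect w x y z := rfl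

/-! ### Coherence of the defects -/

lemma add_pentagon_defect (r s t u : R) :
    V.addAssocDefect r s t + V.addAssocDefect r (s + t) u + V.addAssocDefect s t u =
      V.addAssocDefect (r + s) t u + V.addAssocDefect r s (t + u) := by
  obtain ⟨⟨r, rfl⟩, ⟨s, rfl⟩, ⟨t, rfl⟩, ⟨u, rfl⟩⟩ :=
    X.cls_surjective r, X.cls_surjective s, X.cls_surjective t, X.cls_surjective u
  have h := congrArg V.val (MonoidalCategory.pentagon r s t u)
  simp only [V.val_comp, val_whiskerLeft, val_whiskerRight] at h
  simp only [← X.cls_tensor, addAssocDefect_cls]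
  linear_combination (norm := abel) h

lemma add_hexagon_defect (r s t : R) :
    V.addAssocDefect r s t + V.addSymmDefect r (s + t) + V.addAssocDefect s t r =
      V.addSymmDefect r s + V.addAssocDefect s r t + V.addSymmDefect r t := by
  obtain ⟨⟨r, rfl⟩, ⟨s, rfl⟩, ⟨t, rfl⟩⟩ :=
    X.cls_surjective r, X.cls_surjective s, X.cls_surjective t
  have h := congrArg V.val (BraidedCategory.hexagon_forward r s t)
  simp only [V.val_comp, val_whiskerLeft, val_whiskerRight] at h
  simp only [← X.cls_tensor, addAssocDefect_cls, addSymmDefect_cls]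
  linear_combination (norm := abel) h

lemma addSymmDefect_add_swap (r s : R) :
    V.addSymmDefect r s + V.addSymmDefect s r = 0 := by
  obtain ⟨⟨r, rfl⟩, ⟨s, rfl⟩⟩ := X.cls_surjective r, X.cls_surjective s
  have h := congrArg V.val (SymmetricCategory.symmetry r s)
  simp only [V.val_comp, val_id] at h
  simp only [addSymmDefect_cls]
  linear_combination (norm := abel) h

lemma addAssocDefect_zero_mid (r s : R) :
    V.addAssocDefect r 0 s = V.addRightUnitDefect r - V.addLeftUnitDefect s := by
  obtain ⟨⟨r, rfl⟩, ⟨s, rfl⟩⟩ := X.cls_surjective r, X.cls_surjective s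
  have h := congrArg V.val (MonoidalCategory.triangle r s)
  simp only [V.val_comp, val_whiskerLeft, val_whiskerRight] at h
  simp only [← X.cls_unit, addAssocDefect_cls, addRightUnitDefect_cls, addLeftUnitDefect_cls]
  linear_combination (norm := abel) h

lemma addAssocDefect_zero_left (r s : R) :
    V.addAssocDefect 0 r s = V.addLeftUnitDefect r - V.addLeftUnitDefect (r + s) := by
  obtain ⟨⟨r, rfl⟩, ⟨s, rfl⟩⟩ := X.cls_surjective r, X.cls_surjective s
  have h := congrArg V.val (leftUnitor_tensor_hom r s)
  simp only [V.val_comp, val_iso_inv, val_whiskerRight] at h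
  simp only [← X.cls_unit, ← X.cls_tensor, addAssocDefect_cls, addLeftUnitDefect_cls]
  linear_combination (norm := abel) h

lemma addAssocDefect_zero_right (r s : R) :
    V.addAssocDefect r s 0 = V.addRightUnitDefect (r + s) - V.addRightUnitDefect s := by
  obtain ⟨⟨r, rfl⟩, ⟨s, rfl⟩⟩ := X.cls_surjective r, X.cls_surjective s
  have h := congrArg V.val (rightUnitor_tensor_hom r s)
  simp only [V.val_comp, val_whiskerLeft] at h
  simp only [← X.cls_unit, ← X.cls_tensor, addAssocDefect_cls, addRightUnitDefect_cls]
  linear_combination (norm := abel) -h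

lemma addSymmDefect_zero_right (r : R) :
    V.addSymmDefect r 0 = V.addRightUnitDefect r - V.addLeftUnitDefect r := by
  obtain ⟨r, rfl⟩ := X.cls_surjective r
  have h := congrArg V.val (braiding_leftUnitor r)
  simp only [V.val_comp] at h
  simp only [← X.cls_unit, addSymmDefect_cls, addRightUnitDefect_cls, addLeftUnitDefect_cls]
  linear_combination (norm := abel) h

lemma addSymmDefect_zero_left (r : R) :
    V.addSymmDefect 0 r = V.addLeftUnitDefect r - V.addRightUnitDefect r := by
  linear_combination (norm := abel) V.addSymmDefect_add_swap 0 r - V.addSymmDefect_zero_right r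

lemma addLeftUnitDefect_zero : V.addLeftUnitDefect 0 = V.addRightUnitDefect 0 := by
  rw [← X.cls_unit, addLeftUnitDefect_cls, addRightUnitDefect_cls, unitors_equal]

lemma mulAssocDefect_one_mid [SMulCommClass R Rᵐᵒᵖ B] (r s : R) :
    V.mulAssocDefect r 1 s = V.mulRightUnitDefect r <• s - r • V.mulLeftUnitDefect s := by
  obtain ⟨⟨r, rfl⟩, ⟨s, rfl⟩⟩ := X.cls_surjective r, X.cls_surjective s
  have h := congrArg V.val (mul_triangle r s)
  simp only [V.val_comp, V.val_mulHom, val_id, smul_zero] at h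
  simp only [← X.cls_one, mulAssocDefect_cls, mulRightUnitDefect_cls, mulLeftUnitDefect_cls,
    smul_add]
  linear_combination (norm := abel) h

lemma mulLeftUnitDefect_one : V.mulLeftUnitDefect 1 = V.mulRightUnitDefect 1 := by
  rw [← X.cls_one, mulLeftUnitDefect_cls, mulRightUnitDefect_cls, oneMul_one]

lemma ldis_add_assoc_defect (r s₀ s₁ s₂ : R) :
    V.leftDistribDefect r (s₀ + s₁) s₂ + V.leftDistribDefect r s₀ s₁
        + V.addAssocDefect (r * s₀) (r * s₁) (r * s₂) =
      r • V.addAssocDefect s₀ s₁ s₂ + V.leftDistribDefect r s₀ (s₁ + s₂)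
        + V.leftDistribDefect r s₁ s₂ := by
  obtain ⟨⟨r, rfl⟩, ⟨s₀, rfl⟩, ⟨s₁, rfl⟩, ⟨s₂, rfl⟩⟩ :=
    X.cls_surjective r, X.cls_surjective s₀, X.cls_surjective s₁, X.cls_surjective s₂
  have h := congrArg V.val (ldis_add_assoc r s₀ s₁ s₂)
  simp only [V.val_comp, V.val_mulHom, V.val_tensorHom, val_id, smul_zero] at h
  simp only [← X.cls_tensor, ← X.cls_mul, addAssocDefect_cls, leftDistribDefect_cls, smul_add,
    smul_sub]
  linear_combination (norm := abel) h

lemma rdis_add_assoc_defect (r₀ r₁ r₂ s : R) :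
    V.rightDistribDefect (r₀ + r₁) r₂ s + V.rightDistribDefect r₀ r₁ s
        + V.addAssocDefect (r₀ * s) (r₁ * s) (r₂ * s) =
      V.addAssocDefect r₀ r₁ r₂ <• s + V.rightDistribDefect r₀ (r₁ + r₂) s
        + V.rightDistribDefect r₁ r₂ s := by
  obtain ⟨⟨r₀, rfl⟩, ⟨r₁, rfl⟩, ⟨r₂, rfl⟩, ⟨s, rfl⟩⟩ :=
    X.cls_surjective r₀, X.cls_surjective r₁, X.cls_surjective r₂, X.cls_surjective s
  have h := congrArg V.val (rdis_add_assoc r₀ r₁ r₂ s)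
  simp only [V.val_comp, V.val_mulHom, V.val_tensorHom, val_id, smul_zero] at h
  simp only [← X.cls_tensor, ← X.cls_mul, addAssocDefect_cls, rightDistribDefect_cls, smul_add,
    smul_sub]
  linear_combination (norm := abel) h

lemma mul_pentagon_defect [SMulCommClass R Rᵐᵒᵖ B] (r s t u : R) :
    r • V.mulAssocDefect s t u - V.mulAssocDefect (r * s) t u + V.mulAssocDefect r (s * t) u
      - V.mulAssocDefect r s (t * u) + V.mulAssocDefect r s t <• u = 0 := by
  obtain ⟨⟨r, rfl⟩, ⟨s, rfl⟩, ⟨t, rfl⟩, ⟨u, rfl⟩⟩ :=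
    X.cls_surjective r, X.cls_surjective s, X.cls_surjective t, X.cls_surjective u
  have h := congrArg V.val (mul_pentagon r s t u)
  simp only [V.val_comp, V.val_mulHom, val_id, smul_zero] at h
  simp only [← X.cls_mul, mulAssocDefect_cls]
  simp only [X.cls_mul, smul_add, smul_sub, mul_smul, MulOpposite.op_mul,
    smul_comm (_ : R) (_ : Rᵐᵒᵖ) (_ : B)]
  linear_combination (norm := abel) h

lemma ldis_assoc_defect [SMulCommClass R Rᵐᵒᵖ B] (r s t₀ t₁ : R) :
    r • V.leftDistribDefect s t₀ t₁ - V.leftDistribDefect (r * s) t₀ t₁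
        + V.leftDistribDefect r (s * t₀) (s * t₁) =
      V.mulAssocDefect r s t₀ + V.mulAssocDefect r s t₁ - V.mulAssocDefect r s (t₀ + t₁) := by
  obtain ⟨⟨r, rfl⟩, ⟨s, rfl⟩, ⟨t₀, rfl⟩, ⟨t₁, rfl⟩⟩ :=
    X.cls_surjective r, X.cls_surjective s, X.cls_surjective t₀, X.cls_surjective t₁
  have h := congrArg V.val (ldis_assoc r s t₀ t₁)
  simp only [V.val_comp, V.val_mulHom, V.val_tensorHom, val_id, smul_zero] at h
  simp only [← X.cls_mul, ← X.cls_tensor, mulAssocDefect_cls, leftDistribDefect_cls]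
  simp only [X.cls_mul, X.cls_tensor, smul_add, smul_sub, mul_smul, add_smul, MulOpposite.op_add]
  linear_combination (norm := abel) h

lemma ldis_rdis_assoc_defect [SMulCommClass R Rᵐᵒᵖ B] (r s₀ s₁ t : R) :
    V.leftDistribDefect r (s₀ * t) (s₁ * t) - V.leftDistribDefect r s₀ s₁ <• t =
      V.rightDistribDefect (r * s₀) (r * s₁) t - r • V.rightDistribDefect s₀ s₁ t
        + (V.mulAssocDefect r s₀ t + V.mulAssocDefect r s₁ t
          - V.mulAssocDefect r (s₀ + s₁) t) := by
  obtain ⟨⟨r, rfl⟩, ⟨s₀, rfl⟩, ⟨s₁, rfl⟩, ⟨t, rfl⟩⟩ :=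
    X.cls_surjective r, X.cls_surjective s₀, X.cls_surjective s₁, X.cls_surjective t
  have h := congrArg V.val (ldis_rdis_assoc r s₀ s₁ t)
  simp only [V.val_comp, V.val_mulHom, V.val_tensorHom, val_id, smul_zero] at h
  simp only [← X.cls_mul, ← X.cls_tensor, mulAssocDefect_cls, leftDistribDefect_cls,
    rightDistribDefect_cls]
  simp only [smul_add, smul_sub, smul_comm (_ : R) (_ : Rᵐᵒᵖ) (_ : B)]
  linear_combination (norm := abel) -h

lemma rdis_assoc_defect [SMulCommClass R Rᵐᵒᵖ B] (r₀ r₁ s t : R) :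
    V.rightDistribDefect (r₀ * s) (r₁ * s) t - V.rightDistribDefect r₀ r₁ (s * t)
        + V.rightDistribDefect r₀ r₁ s <• t =
      -(V.mulAssocDefect r₀ s t + V.mulAssocDefect r₁ s t - V.mulAssocDefect (r₀ + r₁) s t) := by
  obtain ⟨⟨r₀, rfl⟩, ⟨r₁, rfl⟩, ⟨s, rfl⟩, ⟨t, rfl⟩⟩ :=
    X.cls_surjective r₀, X.cls_surjective r₁, X.cls_surjective s, X.cls_surjective t
  have h := congrArg V.val (rdis_assoc r₀ r₁ s t)
  simp only [V.val_comp, V.val_mulHom, V.val_tensorHom, val_id, smul_zero] at h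
  simp only [← X.cls_mul, ← X.cls_tensor, mulAssocDefect_cls, rightDistribDefect_cls]
  simp only [X.cls_mul, X.cls_tensor, smul_add, smul_sub, mul_smul, add_smul, MulOpposite.op_mul]
  linear_combination (norm := abel) h

lemma ldis_interchange_defect (r w x y z : R) :
    V.interchangeDefect (r * w) (r * x) (r * y) (r * z) - r • V.interchangeDefect w x y z =
      (V.leftDistribDefect r w y + V.leftDistribDefect r x z
          - V.leftDistribDefect r (w + x) (y + z))
        - (V.leftDistribDefect r w x + V.leftDistribDefect r y z
          - V.leftDistribDefect r (w + y) (x + z)) := by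
  obtain ⟨⟨r, rfl⟩, ⟨w, rfl⟩, ⟨x, rfl⟩, ⟨y, rfl⟩, ⟨z, rfl⟩⟩ :=
    X.cls_surjective r, X.cls_surjective w, X.cls_surjective x, X.cls_surjective y,
    X.cls_surjective z
  have h := congrArg V.val (ldis_interchange r w x y z)
  simp only [V.val_comp, V.val_mulHom, V.val_tensorHom, val_id, smul_zero] at h
  simp only [← X.cls_mul, ← X.cls_tensor, interchangeDefect_cls, leftDistribDefect_cls, smul_add,
    smul_sub]
  linear_combination (norm := abel) h

lemma rdis_ldis_interchange_defect (r₀ r₁ s₀ s₁ : R) :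
    V.interchangeDefect (r₀ * s₀) (r₀ * s₁) (r₁ * s₀) (r₁ * s₁) =
      (V.rightDistribDefect r₀ r₁ s₀ + V.rightDistribDefect r₀ r₁ s₁
          - V.rightDistribDefect r₀ r₁ (s₀ + s₁))
        - (V.leftDistribDefect r₀ s₀ s₁ + V.leftDistribDefect r₁ s₀ s₁
          - V.leftDistribDefect (r₀ + r₁) s₀ s₁) := by
  obtain ⟨⟨r₀, rfl⟩, ⟨r₁, rfl⟩, ⟨s₀, rfl⟩, ⟨s₁, rfl⟩⟩ :=
    X.cls_surjective r₀, X.cls_surjective r₁, X.cls_surjective s₀, X.cls_surjective s₁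
  have h := congrArg V.val (rdis_ldis_interchange r₀ r₁ s₀ s₁)
  simp only [V.val_comp, V.val_tensorHom] at h
  simp only [← X.cls_mul, ← X.cls_tensor, interchangeDefect_cls, leftDistribDefect_cls,
    rightDistribDefect_cls]
  simp only [X.cls_tensor, add_smul, MulOpposite.op_add]
  linear_combination (norm := abel) h

lemma rdis_interchange_defect (w x y z s : R) :
    V.interchangeDefect (w * s) (x * s) (y * s) (z * s) - V.interchangeDefect w x y z <• s =
      (V.rightDistribDefect w y s + V.rightDistribDefect x z s
          - V.rightDistribDefect (w + x) (y + z) s)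
        - (V.rightDistribDefect w x s + V.rightDistribDefect y z s
          - V.rightDistribDefect (w + y) (x + z) s) := by
  obtain ⟨⟨w, rfl⟩, ⟨x, rfl⟩, ⟨y, rfl⟩, ⟨z, rfl⟩, ⟨s, rfl⟩⟩ :=
    X.cls_surjective w, X.cls_surjective x, X.cls_surjective y, X.cls_surjective z,
    X.cls_surjective s
  have h := congrArg V.val (rdis_interchange w x y z s)
  simp only [V.val_comp, V.val_mulHom, V.val_tensorHom, val_id, smul_zero] at h
  simp only [← X.cls_mul, ← X.cls_tensor, interchangeDefect_cls, rightDistribDefect_cls, smul_add,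
    smul_sub]
  linear_combination (norm := abel) h

lemma tensor_associativity_defect (x₀ x₁ y₀ y₁ z₀ z₁ : R) :
    V.interchangeDefect x₀ x₁ y₀ y₁ + V.interchangeDefect (x₀ + y₀) (x₁ + y₁) z₀ z₁
        + V.addAssocDefect x₀ y₀ z₀ + V.addAssocDefect x₁ y₁ z₁ =
      V.addAssocDefect (x₀ + x₁) (y₀ + y₁) (z₀ + z₁) + V.interchangeDefect y₀ y₁ z₀ z₁
        + V.interchangeDefect x₀ x₁ (y₀ + z₀) (y₁ + z₁) := by
  obtain ⟨⟨x₀, rfl⟩, ⟨x₁, rfl⟩, ⟨y₀, rfl⟩, ⟨y₁, rfl⟩, ⟨z₀, rfl⟩, ⟨z₁, rfl⟩⟩ :=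
    X.cls_surjective x₀, X.cls_surjective x₁, X.cls_surjective y₀, X.cls_surjective y₁,
    X.cls_surjective z₀, X.cls_surjective z₁
  have h := congrArg V.val (tensor_associativity x₀ x₁ y₀ y₁ z₀ z₁)
  simp only [V.val_comp, V.val_tensorHom, val_whiskerLeft, val_whiskerRight] at h
  simp only [← X.cls_tensor, addAssocDefect_cls, interchangeDefect_cls]
  linear_combination (norm := abel) h

lemma interchangeDefect_addSymmDefect (w x y z : R) :
    V.interchangeDefect w x y z + V.addSymmDefect w y + V.addSymmDefect x z =
      V.addSymmDefect (w + x) (y + z) + V.interchangeDefect y z w x := by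
  have pentagon := V.add_pentagon_defect w x z y
  have hexagon₁ := V.add_hexagon_defect z w x
  have hexagon₂ := V.add_hexagon_defect y w (x + z)
  have hexagon₃ := V.add_hexagon_defect y (w + x) z
  have hexagon₄ := V.add_hexagon_defect (w + x) y z
  have hexagon₅ := V.add_hexagon_defect y x z
  rw [add_comm z y] at pentagon
  rw [← add_assoc w x z] at hexagon₂
  simp only [interchangeDefect_eq]
  rw [add_comm z x]
  linear_combination (norm := abel) hexagon₁ + hexagon₂ - hexagon₃ - hexagon₄ + hexagon₅ - pentagon
    - V.addSymmDefect_add_swap y (w + x) - V.addSymmDefect_add_swap z (w + x)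
    + V.addSymmDefect_add_swap w y + V.addSymmDefect_add_swap x y + V.addSymmDefect_add_swap x z

lemma interchangeDefect_cube (a b c d e f g h : R) :
    V.interchangeDefect (a + b) (c + d) (e + f) (g + h) + V.interchangeDefect a b e f
        + V.interchangeDefect c d g h + V.interchangeDefect (a + e) (b + f) (c + g) (d + h) =
      V.interchangeDefect a b c d + V.interchangeDefect e f g h
        + V.interchangeDefect (a + c) (b + d) (e + g) (f + h)
        + V.interchangeDefect a c e g + V.interchangeDefect b d f h := by
  have assoc₁ := V.tensor_associativity_defect a b c d (e + g) (f + h)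
  have assoc₂ := V.tensor_associativity_defect c d e f g h
  have assoc₃ := V.tensor_associativity_defect e f c d g h
  have assoc₄ := V.tensor_associativity_defect a b e f (c + g) (d + h)
  rw [add_add_add_comm e g f h] at assoc₁
  rw [add_comm e c, add_comm f d] at assoc₃
  rw [add_add_add_comm c g d h, add_left_comm e c g, add_left_comm f d h] at assoc₄
  rw [V.interchangeDefect_eq (a + b), V.interchangeDefect_eq a c,
    V.interchangeDefect_eq b d f h]
  linear_combination (norm := abel) -assoc₁ + assoc₂ - V.interchangeDefect_addSymmDefect c d e f
    - assoc₃ + assoc₄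

theorem isCocycle_cochain [SMulCommClass R Rᵐᵒᵖ B] : V.cochain.IsCocycle where
  eq₁ := V.mul_pentagon_defect
  eq₂ := V.ldis_assoc_defect
  eq₃ := V.ldis_rdis_assoc_defect
  eq₄ := V.rdis_assoc_defect
  eq₅ := V.ldis_interchange_defect
  eq₆ := V.rdis_ldis_interchange_defect
  eq₇ := V.rdis_interchange_defect
  eq₈ a b c d e f g h := by
    simp only [crossEffect, cochain_a, Prod.mk_add_mk]
    linear_combination (norm := abel) -V.interchangeDefect_cube a b c d e f g h

/-! ### Change of valuation -/

/-- The valuation changed by two functions `γ_· = γm` and `γ_+ = γa` on pairs of classes; the sign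
makes the cochain change by the coboundary of `(γm, γa)`. -/
def modify (γm γa : R → R → B) : X.Valuation where
  val := V.val
  κ x y := V.κ x y + γa (X.cls x) (X.cls y)
  ν x y := V.ν x y - γm (X.cls x) (X.cls y)
  val_comp := V.val_comp
  val_unit := V.val_unit
  val_tensorHom f g := by
    rw [V.val_tensorHom, cls_eq f, cls_eq g]
    abel
  val_mulHom f g := by
    rw [V.val_mulHom, cls_eq f, cls_eq g]
    abel

section Modify

variable (γm γa : R → R → B)

lemma addLeftUnitDefect_modify (r : R) :
    (V.modify γm γa).addLeftUnitDefect r = V.addLeftUnitDefect r + γa 0 r := by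
  obtain ⟨x, rfl⟩ := X.cls_surjective r
  simp only [addLeftUnitDefect_cls, modify, cls_unit]
  abel

lemma addRightUnitDefect_modify (r : R) :
    (V.modify γm γa).addRightUnitDefect r = V.addRightUnitDefect r + γa r 0 := by
  obtain ⟨x, rfl⟩ := X.cls_surjective r
  simp only [addRightUnitDefect_cls, modify, cls_unit]
  abel

lemma mulAssocDefect_modify [SMulCommClass R Rᵐᵒᵖ B] (r s t : R) :
    (V.modify γm γa).mulAssocDefect r s t =
      V.mulAssocDefect r s t + (r • γm s t - γm (r * s) t + γm r (s * t) - γm r s <• t) := by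
  obtain ⟨⟨x, rfl⟩, ⟨y, rfl⟩, ⟨z, rfl⟩⟩ :=
    X.cls_surjective r, X.cls_surjective s, X.cls_surjective t
  simp only [mulAssocDefect_cls, modify, cls_mul, smul_sub]
  abel

lemma leftDistribDefect_modify (r s₀ s₁ : R) :
    (V.modify γm γa).leftDistribDefect r s₀ s₁ =
      V.leftDistribDefect r s₀ s₁ + (r • γa s₀ s₁ - γa (r * s₀) (r * s₁)
        + (γm r s₀ + γm r s₁ - γm r (s₀ + s₁))) := by
  obtain ⟨⟨x, rfl⟩, ⟨y, rfl⟩, ⟨z, rfl⟩⟩ :=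
    X.cls_surjective r, X.cls_surjective s₀, X.cls_surjective s₁
  simp only [leftDistribDefect_cls, modify, cls_mul, cls_tensor, smul_add]
  abel

lemma rightDistribDefect_modify (r₀ r₁ s : R) :
    (V.modify γm γa).rightDistribDefect r₀ r₁ s =
      V.rightDistribDefect r₀ r₁ s + (γa r₀ r₁ <• s - γa (r₀ * s) (r₁ * s)
        + (γm r₀ s + γm r₁ s - γm (r₀ + r₁) s)) := by
  obtain ⟨⟨x, rfl⟩, ⟨y, rfl⟩, ⟨z, rfl⟩⟩ :=
    X.cls_surjective r₀, X.cls_surjective r₁, X.cls_surjective s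
  simp only [rightDistribDefect_cls, modify, cls_mul, cls_tensor, smul_add]
  abel

lemma interchangeDefect_modify (w x y z : R) :
    (V.modify γm γa).interchangeDefect w x y z =
      V.interchangeDefect w x y z + ((γa w x + γa y z - γa (w + y) (x + z))
        - (γa w y + γa x z - γa (w + x) (y + z))) := by
  obtain ⟨⟨w, rfl⟩, ⟨x, rfl⟩, ⟨y, rfl⟩, ⟨z, rfl⟩⟩ :=
    X.cls_surjective w, X.cls_surjective x, X.cls_surjective y, X.cls_surjective z
  simp only [interchangeDefect_cls, modify, cls_tensor]
  abel

theorem isCoboundaryOf_modify [SMulCommClass R Rᵐᵒᵖ B] :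
    ((V.modify γm γa).cochain - V.cochain).IsCoboundaryOf γm γa where
  m r s t := sub_eq_iff_eq_add'.2 (V.mulAssocDefect_modify γm γa r s t)
  l r s₀ s₁ := sub_eq_iff_eq_add'.2 (V.leftDistribDefect_modify γm γa r s₀ s₁)
  r r₀ r₁ s := sub_eq_iff_eq_add'.2 (V.rightDistribDefect_modify γm γa r₀ r₁ s)
  a w x y z := sub_eq_iff_eq_add'.2 (V.interchangeDefect_modify γm γa w x y z)

variable {γm γa}

theorem cochain_modify_eq [SMulCommClass R Rᵐᵒᵖ B] {φ : Quadruple R B}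
    (h : (φ - V.cochain).IsCoboundaryOf γm γa) : (V.modify γm γa).cochain = φ :=
  sub_left_injective ((V.isCoboundaryOf_modify γm γa).eq h)

end Modify

/-! ### Normalization -/

/-- Valuations for which both additive unit constraints have the constant defect `c`.  The cochain
only determines the unit constraints up to such a constant, which is why `c` need not vanish. -/
structure IsUnital (c : B) : Prop where
  left : ∀ r, V.addLeftUnitDefect r = c
  right : ∀ r, V.addRightUnitDefect r = c

namespace IsUnital

variable {V} {c : B} (hV : V.IsUnital c)
include hV

lemma addAssocDefect_zero_mid (r s : R) : V.addAssocDefect r 0 s = 0 := by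
  rw [V.addAssocDefect_zero_mid, hV.left, hV.right, sub_self]

lemma addAssocDefect_zero_left (r s : R) : V.addAssocDefect 0 r s = 0 := by
  rw [V.addAssocDefect_zero_left, hV.left, hV.left, sub_self]

lemma addAssocDefect_zero_right (r s : R) : V.addAssocDefect r s 0 = 0 := by
  rw [V.addAssocDefect_zero_right, hV.right, hV.right, sub_self]

lemma addSymmDefect_zero_right (r : R) : V.addSymmDefect r 0 = 0 := by
  rw [V.addSymmDefect_zero_right, hV.left, hV.right, sub_self]

lemma addSymmDefect_zero_left (r : R) : V.addSymmDefect 0 r = 0 := by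
  rw [V.addSymmDefect_zero_left, hV.left, hV.right, sub_self]

lemma addAssocDefect_eq_interchangeDefect (r s t : R) :
    V.addAssocDefect r s t = V.interchangeDefect r s 0 t := by
  simp [interchangeDefect_eq, hV.addAssocDefect_zero_mid, hV.addAssocDefect_zero_left,
    hV.addSymmDefect_zero_right]

lemma interchangeDefect_zero_row (r s : R) : V.interchangeDefect r s 0 0 = 0 := by
  rw [← hV.addAssocDefect_eq_interchangeDefect, hV.addAssocDefect_zero_right]

lemma leftDistribDefect_zero_right_eq (r s t : R) :
    V.leftDistribDefect r s 0 = V.leftDistribDefect r 0 t := by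
  have h := V.ldis_add_assoc_defect r s 0 t
  simp only [hV.addAssocDefect_zero_mid, mul_zero, add_zero, zero_add, smul_zero] at h
  linear_combination (norm := abel) h

lemma rightDistribDefect_zero_right_eq (r s t : R) :
    V.rightDistribDefect r 0 t = V.rightDistribDefect 0 s t := by
  have h := V.rdis_add_assoc_defect r 0 s t
  simp only [hV.addAssocDefect_zero_mid, zero_mul, add_zero, zero_add, smul_zero] at h
  linear_combination (norm := abel) h

theorem isNormalized_cochain [SMulCommClass R Rᵐᵒᵖ B] (hl : ∀ r, V.leftDistribDefect r 0 0 = 0)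
    (hr : ∀ s, V.rightDistribDefect 0 0 s = 0) : V.cochain.IsNormalized := by
  have l₂ (r s : R) : V.leftDistribDefect r 0 s = 0 :=
    (hV.leftDistribDefect_zero_right_eq r 0 s).symm.trans (hl r)
  have l₃ (r s : R) : V.leftDistribDefect r s 0 = 0 :=
    (hV.leftDistribDefect_zero_right_eq r s 0).trans (hl r)
  have r₁ (r s : R) : V.rightDistribDefect 0 r s = 0 :=
    (hV.rightDistribDefect_zero_right_eq 0 r s).symm.trans (hr s)
  have r₂ (r s : R) : V.rightDistribDefect r 0 s = 0 :=
    (hV.rightDistribDefect_zero_right_eq r 0 s).trans (hr s)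
  have a₁ := hV.interchangeDefect_zero_row
  exact
    { m₁ := fun s t => by simpa [r₁] using V.rdis_assoc_defect 0 0 s t
      m₂ := fun r t => by simpa [l₂, r₁] using (V.ldis_rdis_assoc_defect r 0 0 t).symm
      m₃ := fun r s => by simpa [l₂] using (V.ldis_assoc_defect r s 0 0).symm
      l₁ := fun s₀ s₁ => by simpa [a₁, r₁] using V.rdis_ldis_interchange_defect 0 0 s₀ s₁
      l₂ := l₂
      l₃ := l₃
      r₁ := r₁
      r₂ := r₂
      r₃ := fun r₀ r₁ => by simpa [a₁, l₂] using (V.rdis_ldis_interchange_defect r₀ r₁ 0 0).symm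
      a₁ := a₁
      a₂ := fun r s => by
        simp [interchangeDefect_eq, hV.addAssocDefect_zero_mid, hV.addAssocDefect_zero_left,
          hV.addSymmDefect_zero_left]
      a₃ := fun r s => by
        simp [interchangeDefect_eq, hV.addAssocDefect_zero_mid, hV.addAssocDefect_zero_left,
          hV.addAssocDefect_zero_right, hV.addSymmDefect_zero_left]
      a₄ := fun r s => by
        simp [interchangeDefect_eq, hV.addAssocDefect_zero_mid, hV.addAssocDefect_zero_left,
          hV.addSymmDefect_zero_right]
      a₅ := fun r s => by
        simp [interchangeDefect_eq, hV.addAssocDefect_zero_mid, hV.addSymmDefect_zero_left] }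

end IsUnital

/-- Adding this function to `κ` makes the defects of the additive unit constraints vanish. -/
noncomputable def unitCorrection (r s : R) : B :=
  open scoped Classical in
  if s = 0 then -V.addRightUnitDefect r else if r = 0 then -V.addLeftUnitDefect s else 0

lemma isUnital_modify_unitCorrection : (V.modify 0 V.unitCorrection).IsUnital 0 where
  left r := by
    rw [addLeftUnitDefect_modify, unitCorrection]
    split_ifs with h
    · rw [h, addLeftUnitDefect_zero, add_neg_cancel]
    · exact add_neg_cancel _
    · contradiction
  right r := by
    rw [addRightUnitDefect_modify, unitCorrection, if_pos rfl, add_neg_cancel]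

/-- Subtracting this function from `ν` makes the distributivity defects of `r(0 + 0)` and `(0 + 0)s`
vanish. -/
noncomputable def distribCorrection (r s : R) : B :=
  open scoped Classical in
  if s = 0 then -V.leftDistribDefect r 0 0 else if r = 0 then -V.rightDistribDefect 0 0 s else 0

lemma isNormalized_modify_distribCorrection [SMulCommClass R Rᵐᵒᵖ B]
    (hV : V.IsUnital 0) : (V.modify V.distribCorrection 0).cochain.IsNormalized := by
  have h₀ : V.leftDistribDefect 0 0 0 = V.rightDistribDefect 0 0 0 := by
    have h := V.rdis_ldis_interchange_defect 0 0 0 0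
    simp only [mul_zero, add_zero, hV.interchangeDefect_zero_row] at h
    linear_combination (norm := abel) h
  refine IsUnital.isNormalized_cochain (c := 0) ⟨fun r => ?_, fun r => ?_⟩ (fun r => ?_) fun s => ?_
  · rw [addLeftUnitDefect_modify, hV.left]; exact add_zero 0
  · rw [addRightUnitDefect_modify, hV.right]; exact add_zero 0
  · simp [leftDistribDefect_modify, distribCorrection]
  · rw [rightDistribDefect_modify]
    by_cases h : s = 0 <;> simp [distribCorrection, h, h₀]

theorem exists_isNormalized_cochain [SMulCommClass R Rᵐᵒᵖ B] (V : X.Valuation) :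
    ∃ W : X.Valuation, W.cochain.IsNormalized :=
  ⟨_, isNormalized_modify_distribCorrection _ V.isUnital_modify_unitCorrection⟩

section Normalized

variable {V} (hV : V.cochain.IsNormalized)
include hV

lemma smul_addRightUnitDefect_sub (r s t : R) :
    r • (V.addRightUnitDefect s - V.addLeftUnitDefect t) =
      V.addRightUnitDefect (r * s) - V.addLeftUnitDefect (r * t) := by
  have h := V.ldis_add_assoc_defect r s 0 t
  simp only [add_zero, zero_add, mul_zero, ← cochain_l, hV.l₂, hV.l₃, addAssocDefect_zero_mid] at h
  linear_combination (norm := abel) -h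

lemma addRightUnitDefect_sub_smul (r s t : R) :
    (V.addRightUnitDefect s - V.addLeftUnitDefect t) <• r =
      V.addRightUnitDefect (s * r) - V.addLeftUnitDefect (t * r) := by
  have h := V.rdis_add_assoc_defect s 0 t r
  simp only [add_zero, zero_add, zero_mul, ← cochain_r, hV.r₁, hV.r₂, addAssocDefect_zero_mid] at h
  linear_combination (norm := abel) -h

lemma addRightUnitDefect_add (r s : R) : V.addRightUnitDefect (r + s) =
    V.addRightUnitDefect r + V.addRightUnitDefect s - V.addRightUnitDefect 0 := by
  have h := hV.a₁ r s
  simp only [cochain_a, interchangeDefect_eq, addAssocDefect_zero_mid, addAssocDefect_zero_right,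
    addSymmDefect_zero_right, add_zero] at h
  linear_combination (norm := abel_nf) h

lemma addLeftUnitDefect_add (r s : R) : V.addLeftUnitDefect (r + s) =
    V.addLeftUnitDefect r + V.addLeftUnitDefect s - V.addLeftUnitDefect 0 := by
  have h := hV.a₄ r s
  simp only [cochain_a, interchangeDefect_eq, addAssocDefect_zero_mid, addAssocDefect_zero_left,
    addSymmDefect_zero_right, zero_add] at h
  rw [addLeftUnitDefect_zero]
  linear_combination (norm := abel) -h

theorem exists_cochain_eq_and_isUnital [SMulCommClass R Rᵐᵒᵖ B] :
    ∃ (W : X.Valuation) (c : B), W.cochain = V.cochain ∧ W.IsUnital c := by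
  have hz := V.addLeftUnitDefect_zero
  refine ⟨V.modify 0 fun r s => V.addRightUnitDefect 0 - V.addRightUnitDefect r
    + V.addLeftUnitDefect 0 - V.addLeftUnitDefect s, V.addRightUnitDefect 0,
    V.cochain_modify_eq (γm := 0) ?_, fun r => ?_, fun r => ?_⟩
  · rw [sub_self]
    refine ⟨fun r s t => ?_, fun r s₀ s₁ => ?_, fun r₀ r₁ s => ?_, fun w x y z => ?_⟩
    · change (0 : B) = _
      simp
    · have h₁ := smul_addRightUnitDefect_sub hV r 0 s₁
      have h₂ := smul_addRightUnitDefect_sub hV r s₀ 0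
      change (0 : B) = _
      simp only [mul_zero, crossEffect, Pi.zero_apply, smul_add, smul_sub] at h₁ h₂ ⊢
      rw [hz] at h₂ ⊢
      linear_combination (norm := abel) -h₁ + h₂
    · have h₁ := addRightUnitDefect_sub_smul hV s 0 r₁
      have h₂ := addRightUnitDefect_sub_smul hV s r₀ 0
      change (0 : B) = _
      simp only [zero_mul, crossEffect, Pi.zero_apply, smul_add, smul_sub] at h₁ h₂ ⊢
      rw [hz] at h₂ ⊢
      linear_combination (norm := abel) -h₁ + h₂
    · change (0 : B) = _
      simp only [crossEffect, Prod.mk_add_mk, addRightUnitDefect_add hV, addLeftUnitDefect_add hV]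
      abel
  · rw [addLeftUnitDefect_modify, hz]
    abel
  · rw [addRightUnitDefect_modify]
    abel

end Normalized

/-! ### Characteristic cochains -/

section Choices

variable {V} {obj : R → X.C} (hobj : ∀ r, X.cls (obj r) = r)
  {σm : ∀ r s : R, obj r ⊙ obj s ⟶ obj (r * s)} {σa : ∀ r s : R, obj r ⊗ obj s ⟶ obj (r + s)}
  {γm γa : R → R → B} (hσm : ∀ r s, V.val (σm r s) = γm r s - V.ν (obj r) (obj s))
  (hσa : ∀ r s, V.val (σa r s) = -γa r s - V.κ (obj r) (obj s))
include hobj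

include hσm in
lemma mulAssoc_comp_eq_shift_iff [SMulCommClass R Rᵐᵒᵖ B] (r s t : R) (b : B) :
    (mulAssoc (obj r) (obj s) (obj t)).hom ≫ (𝟙 (obj r) ⊙ₘ σm s t) ≫ σm r (s * t) =
        X.shift ((σm r s ⊙ₘ 𝟙 (obj t)) ≫ σm (r * s) t ≫
          eqToHom (congrArg obj (mul_assoc r s t))) b ↔
      (V.modify γm γa).mulAssocDefect r s t = b := by
  have h := V.mulAssocDefect_cls (obj r) (obj s) (obj t)
  simp only [hobj] at h
  rw [← V.val_injective.eq_iff, mulAssocDefect_modify, h]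
  simp only [V.val_comp, V.val_mulHom, val_shift, val_id, val_eqToHom, smul_zero, hobj, hσm,
    smul_sub]
  constructor <;> intro e <;> linear_combination (norm := abel) e

include hσm hσa in
lemma ldis_comp_eq_shift_iff (r s₀ s₁ : R) (b : B) :
    ldis (obj r) (obj s₀) (obj s₁) ≫ (σm r s₀ ⊗ₘ σm r s₁) ≫ σa (r * s₀) (r * s₁) =
        X.shift ((𝟙 (obj r) ⊙ₘ σa s₀ s₁) ≫ σm r (s₀ + s₁) ≫
          eqToHom (congrArg obj (mul_add r s₀ s₁))) b ↔
      (V.modify γm γa).leftDistribDefect r s₀ s₁ = b := by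
  have h := V.leftDistribDefect_cls (obj r) (obj s₀) (obj s₁)
  simp only [hobj] at h
  rw [← V.val_injective.eq_iff, leftDistribDefect_modify, h]
  simp only [V.val_comp, V.val_mulHom, V.val_tensorHom, val_shift, val_id, val_eqToHom, smul_zero,
    hobj, hσm, hσa, smul_sub, smul_neg]
  constructor <;> intro e <;> linear_combination (norm := abel) e

include hσm hσa in
lemma rdis_comp_eq_shift_iff (r₀ r₁ s : R) (b : B) :
    rdis (obj r₀) (obj r₁) (obj s) ≫ (σm r₀ s ⊗ₘ σm r₁ s) ≫ σa (r₀ * s) (r₁ * s) =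
        X.shift ((σa r₀ r₁ ⊙ₘ 𝟙 (obj s)) ≫ σm (r₀ + r₁) s ≫
          eqToHom (congrArg obj (add_mul r₀ r₁ s))) b ↔
      (V.modify γm γa).rightDistribDefect r₀ r₁ s = b := by
  have h := V.rightDistribDefect_cls (obj r₀) (obj r₁) (obj s)
  simp only [hobj] at h
  rw [← V.val_injective.eq_iff, rightDistribDefect_modify, h]
  simp only [V.val_comp, V.val_mulHom, V.val_tensorHom, val_shift, val_id, val_eqToHom, smul_zero,
    hobj, hσm, hσa, smul_sub, smul_neg]
  constructor <;> intro e <;> linear_combination (norm := abel) e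

include hσa in
lemma tensorμ_comp_eq_shift_iff (w x y z : R) (b : B) :
    tensorμ (obj w) (obj x) (obj y) (obj z) ≫ (σa w y ⊗ₘ σa x z) ≫ σa (w + y) (x + z) =
        X.shift ((σa w x ⊗ₘ σa y z) ≫ σa (w + x) (y + z) ≫
          eqToHom (congrArg obj (add_add_add_comm w x y z))) b ↔
      (V.modify γm γa).interchangeDefect w x y z = b := by
  have h := V.interchangeDefect_cls (obj w) (obj x) (obj y) (obj z)
  simp only [hobj] at h
  rw [← V.val_injective.eq_iff, interchangeDefect_modify, h]
  simp only [V.val_comp, V.val_tensorHom, val_shift, val_eqToHom, hσa]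
  constructor <;> intro e <;> linear_combination (norm := abel) e

end Choices

variable [SMulCommClass R Rᵐᵒᵖ B] {φ : Quadruple R B}

theorem isCharacteristic_iff_exists_modify :
    X.IsCharacteristic φ ↔ ∃ γm γa, (V.modify γm γa).cochain = φ := by
  constructor
  · rintro ⟨obj, hobj, σm, σa, hm, hl, hr, ha⟩
    let γm r s := V.val (σm r s) + V.ν (obj r) (obj s)
    let γa r s := -V.val (σa r s) - V.κ (obj r) (obj s)
    have hσm (r s) : V.val (σm r s) = γm r s - V.ν (obj r) (obj s) :=
      (add_sub_cancel_right _ _).symm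
    have hσa (r s) : V.val (σa r s) = -γa r s - V.κ (obj r) (obj s) := by
      simp only [γa]; abel
    exact ⟨γm, γa, Quadruple.ext
      (fun r s t => (mulAssoc_comp_eq_shift_iff hobj hσm r s t _).1 (hm r s t))
      (fun r s₀ s₁ => (ldis_comp_eq_shift_iff hobj hσm hσa r s₀ s₁ _).1 (hl r s₀ s₁))
      (fun r₀ r₁ s => (rdis_comp_eq_shift_iff hobj hσm hσa r₀ r₁ s _).1 (hr r₀ r₁ s))
      fun w x y z => (tensorμ_comp_eq_shift_iff hobj hσa w x y z _).1 (ha w x y z)⟩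
  · rintro ⟨γm, γa, rfl⟩
    let σm (r s : R) : X.rep r ⊙ X.rep s ⟶ X.rep (r * s) :=
      V.homOf (by rw [cls_mul, cls_rep, cls_rep, cls_rep]) (γm r s - V.ν (X.rep r) (X.rep s))
    let σa (r s : R) : X.rep r ⊗ X.rep s ⟶ X.rep (r + s) :=
      V.homOf (by rw [cls_tensor, cls_rep, cls_rep, cls_rep]) (-γa r s - V.κ (X.rep r) (X.rep s))
    have hσm (r s) : V.val (σm r s) = γm r s - V.ν (X.rep r) (X.rep s) := V.val_homOf _ _
    have hσa (r s) : V.val (σa r s) = -γa r s - V.κ (X.rep r) (X.rep s) := V.val_homOf _ _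
    exact ⟨X.rep, X.cls_rep, σm, σa,
      fun r s t => (mulAssoc_comp_eq_shift_iff X.cls_rep hσm r s t _).2 rfl,
      fun r s₀ s₁ => (ldis_comp_eq_shift_iff X.cls_rep hσm hσa r s₀ s₁ _).2 rfl,
      fun r₀ r₁ s => (rdis_comp_eq_shift_iff X.cls_rep hσm hσa r₀ r₁ s _).2 rfl,
      fun w x y z => (tensorμ_comp_eq_shift_iff X.cls_rep hσa w x y z _).2 rfl⟩

theorem isCharacteristic_iff :
    X.IsCharacteristic φ ↔ ∃ γm γa, (φ - V.cochain).IsCoboundaryOf γm γa := by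
  rw [V.isCharacteristic_iff_exists_modify]
  refine exists₂_congr fun γm γa => ⟨?_, V.cochain_modify_eq⟩
  rintro rfl
  exact V.isCoboundaryOf_modify γm γa

theorem isCharacteristic_cochain : X.IsCharacteristic V.cochain := by
  rw [V.isCharacteristic_iff, sub_self]
  exact (B3 R B).zero_mem

end Valuation

section Characteristic

variable [SMulCommClass R Rᵐᵒᵖ B] {X} {φ : Quadruple R B}

theorem isCharacteristic_iff_exists_valuation :
    X.IsCharacteristic φ ↔ ∃ V : X.Valuation, V.cochain = φ := by
  constructor
  · intro h
    obtain ⟨γm, γa, h⟩ := X.repValuation.isCharacteristic_iff_exists_modify.1 h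
    exact ⟨_, h⟩
  · rintro ⟨V, rfl⟩
    exact V.isCharacteristic_cochain

lemma IsCharacteristic.isCocycle (h : X.IsCharacteristic φ) : φ.IsCocycle := by
  obtain ⟨V, rfl⟩ := isCharacteristic_iff_exists_valuation.1 h
  exact V.isCocycle_cochain

variable (X) in
theorem exists_isNormalized_isCharacteristic :
    ∃ φ : Quadruple R B, φ.IsNormalized ∧ X.IsCharacteristic φ := by
  obtain ⟨V, hV⟩ := X.repValuation.exists_isNormalized_cochain
  exact ⟨V.cochain, hV, V.isCharacteristic_cochain⟩

end Characteristic

end CrossedExtension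

/-! ### Pulling back valuations along 2-homomorphisms -/

section MulLaxMonoidal

variable {C D : Type u} [Category.{v} C] [Category.{v} D] [MulStructure C] [MulStructure D]
  {F : C ⥤ D}

lemma mulLaxMonoidal_associativity
    (h : @Functor.LaxMonoidal C _ MulStructure.mon D _ MulStructure.mon F) (x y z : C) :
    (h.μ x y ⊙ₘ 𝟙 (F.obj z)) ≫ h.μ (x ⊙ y) z ≫ F.map (mulAssoc x y z).hom =
      (mulAssoc (F.obj x) (F.obj y) (F.obj z)).hom ≫ (𝟙 (F.obj x) ⊙ₘ h.μ y z) ≫ h.μ x (y ⊙ z) := by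
  let _ := MulStructure.mon (C := C)
  let _ := MulStructure.mon (C := D)
  have e := h.associativity x y z
  rw [← MonoidalCategory.tensorHom_id, ← MonoidalCategory.id_tensorHom] at e
  exact e

/-- A lax monoidal structure for the multiplication, given in terms of `⊙`. -/
abbrev mulLaxMonoidal (ε : oneObj D ⟶ F.obj (oneObj C))
    (μ : ∀ x y : C, F.obj x ⊙ F.obj y ⟶ F.obj (x ⊙ y))
    (natural : ∀ {x x' y y' : C} (f : x ⟶ x') (g : y ⟶ y'),
      (F.map f ⊙ₘ F.map g) ≫ μ x' y' = μ x y ≫ F.map (f ⊙ₘ g))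
    (assoc : ∀ x y z : C, (μ x y ⊙ₘ 𝟙 (F.obj z)) ≫ μ (x ⊙ y) z ≫ F.map (mulAssoc x y z).hom =
      (mulAssoc (F.obj x) (F.obj y) (F.obj z)).hom ≫ (𝟙 (F.obj x) ⊙ₘ μ y z) ≫ μ x (y ⊙ z))
    (left : ∀ x : C, (oneMul (F.obj x)).hom =
      (ε ⊙ₘ 𝟙 (F.obj x)) ≫ μ (oneObj C) x ≫ F.map (oneMul x).hom)
    (right : ∀ x : C, (mulOne (F.obj x)).hom =
      (𝟙 (F.obj x) ⊙ₘ ε) ≫ μ x (oneObj C) ≫ F.map (mulOne x).hom) :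
    @Functor.LaxMonoidal C _ MulStructure.mon D _ MulStructure.mon F :=
  letI := MulStructure.mon (C := C)
  letI := MulStructure.mon (C := D)
  Functor.LaxMonoidal.ofTensorHom ε μ natural assoc left right

end MulLaxMonoidal

section TwoHom

variable {C D : Type u} [Groupoid.{v} C] [MonoidalCategory C] [SymmetricCategory C]
  [MulStructure C] [CategoricalRing C] [Groupoid.{v} D] [MonoidalCategory D] [SymmetricCategory D]
  [MulStructure D] [CategoricalRing D] (f : TwoHom C D)

namespace TwoHom

/-- The structure morphism `f x + f y ⟶ f (x + y)` of a 2-homomorphism. -/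
def addMap (x y : C) : f.F.obj x ⊗ f.F.obj y ⟶ f.F.obj (x ⊗ y) := f.addMonoidal.μ x y

/-- The structure morphism `f x f y ⟶ f (x y)` of a 2-homomorphism, typed by `⊙` instead of the
tensor product of the structure `MulStructure.mon`. -/
def mulMap (x y : C) : f.F.obj x ⊙ f.F.obj y ⟶ f.F.obj (x ⊙ y) := f.mulMonoidal.μ x y

lemma addMap_natural {x x' y y' : C} (g : x ⟶ x') (h : y ⟶ y') :
    (f.F.map g ⊗ₘ f.F.map h) ≫ f.addMap x' y' = f.addMap x y ≫ f.F.map (g ⊗ₘ h) :=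
  let _ := f.addMonoidal; Functor.LaxMonoidal.μ_natural f.F g h

lemma addMap_assoc (x y z : C) :
    f.addMap x y ▷ f.F.obj z ≫ f.addMap (x ⊗ y) z ≫ f.F.map (α_ x y z).hom =
      (α_ (f.F.obj x) (f.F.obj y) (f.F.obj z)).hom ≫ f.F.obj x ◁ f.addMap y z ≫
        f.addMap x (y ⊗ z) :=
  let _ := f.addMonoidal; Functor.LaxMonoidal.associativity f.F x y z

lemma mulMap_natural {x x' y y' : C} (g : x ⟶ x') (h : y ⟶ y') :
    (f.F.map g ⊙ₘ f.F.map h) ≫ f.mulMap x' y' = f.mulMap x y ≫ f.F.map (g ⊙ₘ h) :=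
  @Functor.LaxMonoidal.μ_natural C _ MulStructure.mon D _ MulStructure.mon f.F f.mulMonoidal
    _ _ _ _ g h

lemma mulMap_assoc (x y z : C) :
    (f.mulMap x y ⊙ₘ 𝟙 (f.F.obj z)) ≫ f.mulMap (x ⊙ y) z ≫ f.F.map (mulAssoc x y z).hom =
      (mulAssoc (f.F.obj x) (f.F.obj y) (f.F.obj z)).hom ≫ (𝟙 (f.F.obj x) ⊙ₘ f.mulMap y z) ≫
        f.mulMap x (y ⊙ z) :=
  mulLaxMonoidal_associativity f.mulMonoidal x y z

lemma ldis_mulMap (x y z : C) :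
    ldis (f.F.obj x) (f.F.obj y) (f.F.obj z) ≫ (f.mulMap x y ⊗ₘ f.mulMap x z) ≫
        f.addMap (x ⊙ y) (x ⊙ z) =
      (𝟙 (f.F.obj x) ⊙ₘ f.addMap y z) ≫ f.mulMap x (y ⊗ z) ≫ f.F.map (ldis x y z) :=
  f.ldis_comp x y z

lemma rdis_mulMap (x y z : C) :
    rdis (f.F.obj x) (f.F.obj y) (f.F.obj z) ≫ (f.mulMap x z ⊗ₘ f.mulMap y z) ≫
        f.addMap (x ⊙ z) (y ⊙ z) =
      (f.addMap x y ⊙ₘ 𝟙 (f.F.obj z)) ≫ f.mulMap (x ⊗ y) z ≫ f.F.map (rdis x y z) :=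
  f.rdis_comp x y z

end TwoHom

end TwoHom

namespace CrossedExtension

variable {R : Type u} [Ring R] {B : Type v} [AddCommGroup B] [Module R B] [Module Rᵐᵒᵖ B]
  {X Y : CrossedExtension R B}

/-- A 2-homomorphism of crossed extensions that induces the identity on `π₀ = R` and `π₁ = B`. -/
structure InducesIdentity (f : TwoHom X.C Y.C) : Prop where
  cls_obj : ∀ x, Y.cls (f.F.obj x) = X.cls x
  pi1_map : ∀ β : 𝟙_ X.C ⟶ 𝟙_ X.C,
    Y.pi1 (f.addMonoidal.ε ≫ f.F.map β ≫ inv f.addMonoidal.ε) = X.pi1 β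

lemma rel_iff_exists_inducesIdentity : X.Rel Y ↔ ∃ f : TwoHom X.C Y.C, InducesIdentity f :=
  exists_congr fun _ => ⟨fun h => ⟨h.1, h.2⟩, fun h => ⟨h.cls_obj, h.pi1_map⟩⟩

namespace Valuation

section Pullback

variable {f : TwoHom X.C Y.C} (W : Y.Valuation) (hf : InducesIdentity f)

/-- The pullback of a valuation along a 2-homomorphism that induces the identity on `π₀` and
`π₁`. -/
@[simps] def pullback : X.Valuation where
  val g := W.val (f.F.map g)
  κ x y := W.κ (f.F.obj x) (f.F.obj y) + W.val (f.addMap x y)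
  ν x y := W.ν (f.F.obj x) (f.F.obj y) + W.val (f.mulMap x y)
  val_comp g h := by rw [f.F.map_comp, W.val_comp]
  val_unit β := by
    rw [← hf.pi1_map, ← W.val_unit]
    simp only [W.val_comp, val_inv]
    abel
  val_tensorHom g h := by
    have e := congrArg W.val (f.addMap_natural g h)
    simp only [W.val_comp, W.val_tensorHom] at e
    linear_combination (norm := abel) -e
  val_mulHom g h := by
    have e := congrArg W.val (f.mulMap_natural g h)
    simp only [W.val_comp, W.val_mulHom, hf.cls_obj] at e
    linear_combination (norm := abel) -e

lemma addAssocDefect_pullback (r s t : R) :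
    (W.pullback hf).addAssocDefect r s t = W.addAssocDefect r s t := by
  obtain ⟨⟨x, rfl⟩, ⟨y, rfl⟩, ⟨z, rfl⟩⟩ := X.cls_surjective r, X.cls_surjective s,
    X.cls_surjective t
  have e := congrArg W.val (f.addMap_assoc x y z)
  simp only [W.val_comp, val_whiskerLeft, val_whiskerRight] at e
  rw [addAssocDefect_cls, ← hf.cls_obj, ← hf.cls_obj, ← hf.cls_obj, addAssocDefect_cls]
  simp only [pullback_val, pullback_κ]
  linear_combination (norm := abel) e

lemma mulAssocDefect_pullback [SMulCommClass R Rᵐᵒᵖ B] (r s t : R) :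
    (W.pullback hf).mulAssocDefect r s t = W.mulAssocDefect r s t := by
  obtain ⟨⟨x, rfl⟩, ⟨y, rfl⟩, ⟨z, rfl⟩⟩ := X.cls_surjective r, X.cls_surjective s,
    X.cls_surjective t
  have e := congrArg W.val (f.mulMap_assoc x y z)
  simp only [W.val_comp, W.val_mulHom, val_id, smul_zero] at e
  rw [mulAssocDefect_cls, ← hf.cls_obj, ← hf.cls_obj, ← hf.cls_obj, mulAssocDefect_cls]
  simp only [pullback_val, pullback_ν, smul_add]
  linear_combination (norm := abel) e

lemma leftDistribDefect_pullback (r s₀ s₁ : R) :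
    (W.pullback hf).leftDistribDefect r s₀ s₁ = W.leftDistribDefect r s₀ s₁ := by
  obtain ⟨⟨x, rfl⟩, ⟨y, rfl⟩, ⟨z, rfl⟩⟩ := X.cls_surjective r, X.cls_surjective s₀,
    X.cls_surjective s₁
  have e := congrArg W.val (f.ldis_mulMap x y z)
  simp only [W.val_comp, W.val_mulHom, W.val_tensorHom, val_id, smul_zero] at e
  rw [leftDistribDefect_cls, ← hf.cls_obj, ← hf.cls_obj, ← hf.cls_obj, leftDistribDefect_cls]
  simp only [pullback_val, pullback_κ, pullback_ν, smul_add]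
  linear_combination (norm := abel) -e

lemma rightDistribDefect_pullback (r₀ r₁ s : R) :
    (W.pullback hf).rightDistribDefect r₀ r₁ s = W.rightDistribDefect r₀ r₁ s := by
  obtain ⟨⟨x, rfl⟩, ⟨y, rfl⟩, ⟨z, rfl⟩⟩ := X.cls_surjective r₀, X.cls_surjective r₁,
    X.cls_surjective s
  have e := congrArg W.val (f.rdis_mulMap x y z)
  simp only [W.val_comp, W.val_mulHom, W.val_tensorHom, val_id, smul_zero] at e
  rw [rightDistribDefect_cls, ← hf.cls_obj, ← hf.cls_obj, ← hf.cls_obj, rightDistribDefect_cls]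
  simp only [pullback_val, pullback_κ, pullback_ν, smul_add]
  linear_combination (norm := abel) -e

-- A 2-homomorphism is not required to be symmetric: comparing the two ways of multiplying out
-- `(1 + 1) (r + s)` shows that it is.
lemma addSymmDefect_pullback (r s : R) :
    (W.pullback hf).addSymmDefect r s = W.addSymmDefect r s := by
  have h₁ := (W.pullback hf).rdis_ldis_interchange_defect 1 1 s r
  have h₂ := W.rdis_ldis_interchange_defect 1 1 s r
  simp only [interchangeDefect_eq, addAssocDefect_pullback, leftDistribDefect_pullback,
    rightDistribDefect_pullback, one_mul] at h₁ h₂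
  linear_combination (norm := abel) h₁ - h₂

theorem cochain_pullback [SMulCommClass R Rᵐᵒᵖ B] : (W.pullback hf).cochain = W.cochain :=
  Quadruple.ext (W.mulAssocDefect_pullback hf) (W.leftDistribDefect_pullback hf)
    (W.rightDistribDefect_pullback hf) fun w x y z => by
      simp only [cochain_a, interchangeDefect_eq, addAssocDefect_pullback, addSymmDefect_pullback]

end Pullback

/-! ### The 2-homomorphism of valuations with equal cochains -/

section Comparison

variable (V : X.Valuation) (W : Y.Valuation)

/-- The functor that sends an object to the chosen object of the same class and preserves values. -/
noncomputable def functor : X.C ⥤ Y.C where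
  obj x := Y.rep (X.cls x)
  map f := W.homOf (congrArg (fun r => Y.cls (Y.rep r)) (cls_eq f)) (V.val f)
  map_id x := W.val_injective (by rw [val_homOf, val_id, val_id])
  map_comp f g := W.val_injective (by rw [W.val_comp, val_homOf, val_homOf, val_homOf, V.val_comp])

@[simp] lemma cls_functor_obj (x : X.C) : Y.cls ((V.functor W).obj x) = X.cls x := Y.cls_rep _

@[simp] lemma val_functor_map {x y : X.C} (f : x ⟶ y) :
    W.val ((V.functor W).map f) = V.val f :=
  W.val_homOf (congrArg (fun r => Y.cls (Y.rep r)) (cls_eq f)) _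

/-- The structure morphism of `V.functor W` for the addition.  Its value is the one that makes the
structure morphisms natural. -/
noncomputable def addComparison (x y : X.C) :
    (V.functor W).obj x ⊗ (V.functor W).obj y ⟶ (V.functor W).obj (x ⊗ y) :=
  W.homOf (by simp only [cls_tensor, cls_functor_obj])
    (V.κ x y - W.κ ((V.functor W).obj x) ((V.functor W).obj y))

@[simp] lemma val_addComparison (x y : X.C) : W.val (V.addComparison W x y) =
    V.κ x y - W.κ ((V.functor W).obj x) ((V.functor W).obj y) :=
  W.val_homOf _ _

/-- The structure morphism of `V.functor W` for the multiplication. -/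
noncomputable def mulComparison (x y : X.C) :
    (V.functor W).obj x ⊙ (V.functor W).obj y ⟶ (V.functor W).obj (x ⊙ y) :=
  W.homOf (by simp only [cls_mul, cls_functor_obj])
    (V.ν x y - W.ν ((V.functor W).obj x) ((V.functor W).obj y))

@[simp] lemma val_mulComparison (x y : X.C) : W.val (V.mulComparison W x y) =
    V.ν x y - W.ν ((V.functor W).obj x) ((V.functor W).obj y) :=
  W.val_homOf _ _

/-- The structure morphism of `V.functor W` for the multiplicative unit. -/
noncomputable def oneComparison : oneObj Y.C ⟶ (V.functor W).obj (oneObj X.C) :=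
  W.homOf (by simp only [cls_one, cls_functor_obj])
    (W.mulRightUnitDefect 1 - V.mulRightUnitDefect 1)

@[simp] lemma val_oneComparison :
    W.val (V.oneComparison W) = W.mulRightUnitDefect 1 - V.mulRightUnitDefect 1 :=
  W.val_homOf _ _

lemma addComparison_natural {x x' y y' : X.C} (f : x ⟶ x') (g : y ⟶ y') :
    ((V.functor W).map f ⊗ₘ (V.functor W).map g) ≫ V.addComparison W x' y' =
      V.addComparison W x y ≫ (V.functor W).map (f ⊗ₘ g) := by
  apply W.val_injective
  simp only [W.val_comp, V.val_tensorHom, W.val_tensorHom, val_addComparison, val_functor_map]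
  abel

lemma mulComparison_natural {x x' y y' : X.C} (f : x ⟶ x') (g : y ⟶ y') :
    ((V.functor W).map f ⊙ₘ (V.functor W).map g) ≫ V.mulComparison W x' y' =
      V.mulComparison W x y ≫ (V.functor W).map (f ⊙ₘ g) := by
  apply W.val_injective
  simp only [W.val_comp, V.val_mulHom, W.val_mulHom, val_mulComparison, val_functor_map,
    cls_functor_obj]
  abel

variable {V W}

lemma addComparison_assoc (h : V.addAssocDefect = W.addAssocDefect) (x y z : X.C) :
    (V.addComparison W x y ⊗ₘ 𝟙 ((V.functor W).obj z)) ≫ V.addComparison W (x ⊗ y) z ≫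
        (V.functor W).map (α_ x y z).hom =
      (α_ ((V.functor W).obj x) ((V.functor W).obj y) ((V.functor W).obj z)).hom ≫
        (𝟙 ((V.functor W).obj x) ⊗ₘ V.addComparison W y z) ≫ V.addComparison W x (y ⊗ z) := by
  apply W.val_injective
  have h₁ := V.addAssocDefect_cls x y z
  have h₂ := W.addAssocDefect_cls ((V.functor W).obj x) ((V.functor W).obj y) ((V.functor W).obj z)
  simp only [cls_functor_obj] at h₂
  rw [h, h₂] at h₁
  simp only [W.val_comp, W.val_tensorHom, val_addComparison, val_functor_map, val_id]
  linear_combination (norm := abel) -h₁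

lemma mulComparison_assoc [SMulCommClass R Rᵐᵒᵖ B] (h : V.mulAssocDefect = W.mulAssocDefect)
    (x y z : X.C) :
    (V.mulComparison W x y ⊙ₘ 𝟙 ((V.functor W).obj z)) ≫ V.mulComparison W (x ⊙ y) z ≫
        (V.functor W).map (mulAssoc x y z).hom =
      (mulAssoc ((V.functor W).obj x) ((V.functor W).obj y) ((V.functor W).obj z)).hom ≫
        (𝟙 ((V.functor W).obj x) ⊙ₘ V.mulComparison W y z) ≫ V.mulComparison W x (y ⊙ z) := by
  apply W.val_injective
  have h₁ := V.mulAssocDefect_cls x y z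
  have h₂ := W.mulAssocDefect_cls ((V.functor W).obj x) ((V.functor W).obj y) ((V.functor W).obj z)
  simp only [cls_functor_obj] at h₂
  rw [h, h₂] at h₁
  simp only [W.val_comp, W.val_mulHom, val_mulComparison, val_functor_map, cls_functor_obj, val_id,
    smul_zero, smul_sub]
  linear_combination (norm := abel) -h₁

lemma ldis_comp_comparison (h : V.leftDistribDefect = W.leftDistribDefect) (x y z : X.C) :
    ldis ((V.functor W).obj x) ((V.functor W).obj y) ((V.functor W).obj z) ≫
        (V.mulComparison W x y ⊗ₘ V.mulComparison W x z) ≫ V.addComparison W (x ⊙ y) (x ⊙ z) =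
      (𝟙 ((V.functor W).obj x) ⊙ₘ V.addComparison W y z) ≫ V.mulComparison W x (y ⊗ z) ≫
        (V.functor W).map (ldis x y z) := by
  apply W.val_injective
  have h₁ := V.leftDistribDefect_cls x y z
  have h₂ := W.leftDistribDefect_cls ((V.functor W).obj x) ((V.functor W).obj y)
    ((V.functor W).obj z)
  simp only [cls_functor_obj] at h₂
  rw [h, h₂] at h₁
  simp only [W.val_comp, W.val_mulHom, W.val_tensorHom, val_addComparison, val_mulComparison,
    val_functor_map, cls_functor_obj, val_id, smul_zero, smul_sub]
  linear_combination (norm := abel) h₁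

lemma rdis_comp_comparison (h : V.rightDistribDefect = W.rightDistribDefect) (x y z : X.C) :
    rdis ((V.functor W).obj x) ((V.functor W).obj y) ((V.functor W).obj z) ≫
        (V.mulComparison W x z ⊗ₘ V.mulComparison W y z) ≫ V.addComparison W (x ⊙ z) (y ⊙ z) =
      (V.addComparison W x y ⊙ₘ 𝟙 ((V.functor W).obj z)) ≫ V.mulComparison W (x ⊗ y) z ≫
        (V.functor W).map (rdis x y z) := by
  apply W.val_injective
  have h₁ := V.rightDistribDefect_cls x y z
  have h₂ := W.rightDistribDefect_cls ((V.functor W).obj x) ((V.functor W).obj y)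
    ((V.functor W).obj z)
  simp only [cls_functor_obj] at h₂
  rw [h, h₂] at h₁
  simp only [W.val_comp, W.val_mulHom, W.val_tensorHom, val_addComparison, val_mulComparison,
    val_functor_map, cls_functor_obj, val_id, smul_zero, smul_sub]
  linear_combination (norm := abel) h₁

section MulUnit

variable [SMulCommClass R Rᵐᵒᵖ B] (h : V.mulAssocDefect = W.mulAssocDefect)
include h

lemma mulLeftUnitDefect_sub (r : R) : W.mulLeftUnitDefect r - V.mulLeftUnitDefect r =
    (W.mulRightUnitDefect 1 - V.mulRightUnitDefect 1) <• r := by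
  have h₁ := V.mulAssocDefect_one_mid 1 r
  rw [h, W.mulAssocDefect_one_mid, one_smul, one_smul] at h₁
  rw [smul_sub]
  linear_combination (norm := abel) -h₁

lemma mulRightUnitDefect_sub (r : R) : W.mulRightUnitDefect r - V.mulRightUnitDefect r =
    r • (W.mulRightUnitDefect 1 - V.mulRightUnitDefect 1) := by
  have h₁ := V.mulAssocDefect_one_mid r 1
  rw [h, W.mulAssocDefect_one_mid, MulOpposite.op_one, one_smul, one_smul,
    V.mulLeftUnitDefect_one, W.mulLeftUnitDefect_one] at h₁
  rw [smul_sub]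
  linear_combination (norm := abel) h₁

lemma oneComparison_left (x : X.C) : (oneMul ((V.functor W).obj x)).hom =
    (V.oneComparison W ⊙ₘ 𝟙 ((V.functor W).obj x)) ≫ V.mulComparison W (oneObj X.C) x ≫
      (V.functor W).map (oneMul x).hom := by
  apply W.val_injective
  have h₁ := V.mulLeftUnitDefect_cls x
  have h₂ := W.mulLeftUnitDefect_cls ((V.functor W).obj x)
  have h₃ := mulLeftUnitDefect_sub h (X.cls x)
  rw [cls_functor_obj] at h₂
  simp only [W.val_comp, W.val_mulHom, val_oneComparison, val_mulComparison, val_functor_map,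
    cls_functor_obj, val_id, smul_zero]
  linear_combination (norm := abel) h₁ - h₂ + h₃

lemma oneComparison_right (x : X.C) : (mulOne ((V.functor W).obj x)).hom =
    (𝟙 ((V.functor W).obj x) ⊙ₘ V.oneComparison W) ≫ V.mulComparison W x (oneObj X.C) ≫
      (V.functor W).map (mulOne x).hom := by
  apply W.val_injective
  have h₁ := V.mulRightUnitDefect_cls x
  have h₂ := W.mulRightUnitDefect_cls ((V.functor W).obj x)
  have h₃ := mulRightUnitDefect_sub h (X.cls x)
  rw [cls_functor_obj] at h₂
  simp only [W.val_comp, W.val_mulHom, val_oneComparison, val_mulComparison, val_functor_map,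
    cls_functor_obj, val_id, smul_zero]
  linear_combination (norm := abel) h₁ - h₂ + h₃

end MulUnit

variable {c d : B} (hV : V.IsUnital c) (hW : W.IsUnital d)
include hV hW

lemma addAssocDefect_eq_of_cochain_eq (h : V.cochain = W.cochain) :
    V.addAssocDefect = W.addAssocDefect :=
  funext₃ fun r s t => by
    rw [hV.addAssocDefect_eq_interchangeDefect, hW.addAssocDefect_eq_interchangeDefect,
      ← cochain_a, h, cochain_a]

/-- The additive monoidal structure of `V.functor W` for unital valuations with the same additive
associativity defects. -/
noncomputable abbrev addLaxMonoidal (h : V.addAssocDefect = W.addAssocDefect) :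
    (V.functor W).LaxMonoidal :=
  .ofTensorHom (W.homOf (by simp only [cls_unit, cls_functor_obj]) (d - c)) (V.addComparison W)
    (V.addComparison_natural W) (addComparison_assoc h)
    (fun x => W.val_injective (by
      have h₁ := V.addLeftUnitDefect_cls x
      have h₂ := W.addLeftUnitDefect_cls ((V.functor W).obj x)
      rw [hV.left] at h₁
      rw [hW.left] at h₂
      simp only [W.val_comp, W.val_tensorHom, val_homOf, val_addComparison, val_functor_map, val_id]
      linear_combination (norm := abel) h₁ - h₂))
    (fun x => W.val_injective (by
      have h₁ := V.addRightUnitDefect_cls x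
      have h₂ := W.addRightUnitDefect_cls ((V.functor W).obj x)
      rw [hV.right] at h₁
      rw [hW.right] at h₂
      simp only [W.val_comp, W.val_tensorHom, val_homOf, val_addComparison, val_functor_map, val_id]
      linear_combination (norm := abel) h₁ - h₂))

/-- The functor `V.functor W` as a 2-homomorphism, for unital valuations with the same cochain. -/
noncomputable def comparison [SMulCommClass R Rᵐᵒᵖ B] (h : V.cochain = W.cochain) :
    TwoHom X.C Y.C where
  F := V.functor W
  addMonoidal := addLaxMonoidal hV hW (addAssocDefect_eq_of_cochain_eq hV hW h)
  mulMonoidal := mulLaxMonoidal (V.oneComparison W) (V.mulComparison W) (V.mulComparison_natural W)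
    (mulComparison_assoc (congrArg Quadruple.m h)) (oneComparison_left (congrArg Quadruple.m h))
    (oneComparison_right (congrArg Quadruple.m h))
  ldis_comp := ldis_comp_comparison (congrArg Quadruple.l h)
  rdis_comp := rdis_comp_comparison (congrArg Quadruple.r h)

lemma inducesIdentity_comparison [SMulCommClass R Rᵐᵒᵖ B] (h : V.cochain = W.cochain) :
    InducesIdentity (comparison hV hW h) where
  cls_obj := V.cls_functor_obj W
  pi1_map β := by
    have hβ : W.val ((comparison hV hW h).F.map β) = V.val β := V.val_functor_map W β
    rw [← W.val_unit, ← V.val_unit]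
    simp only [W.val_comp, val_inv, hβ]
    abel

end Comparison

end Valuation

/-! ### Equivalence of crossed extensions -/

section Rel

variable [SMulCommClass R Rᵐᵒᵖ B]

theorem rel_of_cochain_eq {V : X.Valuation} {W : Y.Valuation} (hV : V.cochain.IsNormalized)
    (h : V.cochain = W.cochain) : X.Rel Y := by
  obtain ⟨V', c, hV', hc⟩ := V.exists_cochain_eq_and_isUnital hV
  obtain ⟨W', d, hW', hd⟩ := W.exists_cochain_eq_and_isUnital (h ▸ hV)
  exact rel_iff_exists_inducesIdentity.2
    ⟨_, Valuation.inducesIdentity_comparison hc hd (hV'.trans (h.trans hW'.symm))⟩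

theorem Rel.isCharacteristic_iff (h : X.Rel Y) {φ : Quadruple R B} :
    X.IsCharacteristic φ ↔ Y.IsCharacteristic φ := by
  obtain ⟨f, hf⟩ := rel_iff_exists_inducesIdentity.1 h
  rw [Y.repValuation.isCharacteristic_iff, (Y.repValuation.pullback hf).isCharacteristic_iff,
    Y.repValuation.cochain_pullback hf]

theorem rel_iff_isCharacteristic {φ : Quadruple R B} (hφ : φ.IsNormalized)
    (hX : X.IsCharacteristic φ) : X.Rel Y ↔ Y.IsCharacteristic φ := by
  refine ⟨fun h => h.isCharacteristic_iff.1 hX, fun hY => ?_⟩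
  obtain ⟨V, rfl⟩ := isCharacteristic_iff_exists_valuation.1 hX
  obtain ⟨W, hW⟩ := isCharacteristic_iff_exists_valuation.1 hY
  exact rel_of_cochain_eq hφ hW.symm

theorem rel_iff_forall_isCharacteristic :
    X.Rel Y ↔ ∀ φ, X.IsCharacteristic φ ↔ Y.IsCharacteristic φ := by
  refine ⟨fun h _ => h.isCharacteristic_iff, fun h => ?_⟩
  obtain ⟨φ, hφ, hX⟩ := X.exists_isNormalized_isCharacteristic
  exact (rel_iff_isCharacteristic hφ hX).2 ((h φ).1 hX)

theorem rel_equivalence : _root_.Equivalence (Rel (R := R) (B := B)) := by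
  have : Rel (R := R) (B := B) = fun X Y => X.IsCharacteristic = Y.IsCharacteristic := by
    ext X Y
    rw [rel_iff_forall_isCharacteristic, funext_iff]
    exact forall_congr' fun φ => eq_iff_iff.symm
  rw [this]
  exact ⟨fun _ => rfl, Eq.symm, Eq.trans⟩

end Rel

end CrossedExtension

/-! ### The skeletal categorical ring -/

section SkeletalValuation

variable {R : Type u} [Ring R] {B : Type v} [AddCommGroup B] [Module R B] [Module Rᵐᵒᵖ B]
  [SMulCommClass R Rᵐᵒᵖ B] (φ ψ : Z3 R B)

open CrossedExtension

/-- The valuation of the skeletal categorical ring by the `B`-components of morphisms. -/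
def skeletalValuation : (skeletal φ).Valuation where
  val f := SkelHom.val f
  κ _ _ := 0
  ν _ _ := 0
  val_comp _ _ := rfl
  val_unit _ := rfl
  val_tensorHom _ _ := by
    rw [add_zero, sub_zero]
    rfl
  val_mulHom _ _ := by
    rw [add_zero, sub_zero]
    rfl

theorem cochain_skeletalValuation : (skeletalValuation φ).cochain = φ.1.1 := by
  have κ_eq (x y) : (skeletalValuation φ).κ x y = 0 := rfl
  have ν_eq (x y) : (skeletalValuation φ).ν x y = 0 := rfl
  let o (r : R) : (skeletal φ).C := r
  refine Quadruple.ext (fun r s t => ?_) (fun r s t => ?_) (fun r s t => ?_) (fun w x y z => ?_)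
  · refine ((skeletalValuation φ).mulAssocDefect_cls (o r) (o s) (o t)).trans ?_
    simp only [ν_eq, smul_zero, zero_add, sub_zero]
    rfl
  · refine ((skeletalValuation φ).leftDistribDefect_cls (o r) (o s) (o t)).trans ?_
    simp only [κ_eq, ν_eq, smul_zero, zero_add, sub_zero]
    rfl
  · refine ((skeletalValuation φ).rightDistribDefect_cls (o r) (o s) (o t)).trans ?_
    simp only [κ_eq, ν_eq, smul_zero, zero_add, sub_zero]
    rfl
  · refine ((skeletalValuation φ).interchangeDefect_cls (o w) (o x) (o y) (o z)).trans ?_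
    simp only [κ_eq, zero_add, sub_zero]
    exact Skel.tensorμ_val (φ := φ) w x y z

lemma isCharacteristic_skeletal : (skeletal φ).IsCharacteristic φ.1.1 :=
  isCharacteristic_iff_exists_valuation.2 ⟨_, cochain_skeletalValuation φ⟩

theorem rel_skeletal_skeletal_iff :
    (skeletal φ).Rel (skeletal ψ) ↔ φ.1 - ψ.1 ∈ B3 R B := by
  rw [rel_iff_isCharacteristic φ.1.2 (isCharacteristic_skeletal φ),
    (skeletalValuation ψ).isCharacteristic_iff, cochain_skeletalValuation]
  rfl

variable {φ} in
theorem CrossedExtension.IsCharacteristic.rel_skeletal {X : CrossedExtension R B}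
    (h : X.IsCharacteristic φ.1.1) : X.Rel (skeletal φ) :=
  (rel_iff_isCharacteristic φ.1.2 h).2 (isCharacteristic_skeletal φ)

lemma Crext.mk_eq_mk_iff {X Y : CrossedExtension R B} :
    (Quot.mk _ X : Crext R B) = Quot.mk _ Y ↔ X.Rel Y :=
  Quot.eq.trans rel_equivalence.eqvGen_iff

lemma H3.mk_eq_mk_iff_mk_skeletal_eq : (QuotientAddGroup.mk φ : H3 R B) = QuotientAddGroup.mk ψ ↔
    (Quot.mk _ (skeletal φ) : Crext R B) = Quot.mk _ (skeletal ψ) := by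
  rw [Crext.mk_eq_mk_iff, rel_skeletal_skeletal_iff, QuotientAddGroup.eq_iff_sub_mem]
  rfl

/-- The map `H³(R; B) → Crext(R; B)` that sends the class of `φ` to the class of `R_φ`. -/
def H3.toCrext : H3 R B → Crext R B :=
  Quotient.lift (fun φ => Quot.mk _ (skeletal φ)) fun φ ψ h =>
    (H3.mk_eq_mk_iff_mk_skeletal_eq φ ψ).1 (Quotient.sound h)

lemma H3.toCrext_injective : Function.Injective (H3.toCrext (R := R) (B := B)) := by
  rintro ⟨φ⟩ ⟨ψ⟩ h
  exact (H3.mk_eq_mk_iff_mk_skeletal_eq φ ψ).2 h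

lemma H3.toCrext_surjective : Function.Surjective (H3.toCrext (R := R) (B := B)) := by
  rintro ⟨X⟩
  obtain ⟨φ, hφ, hX⟩ := X.exists_isNormalized_isCharacteristic
  let ψ : Z3 R B := ⟨⟨φ, hφ⟩, hX.isCocycle⟩
  exact ⟨QuotientAddGroup.mk ψ, (Crext.mk_eq_mk_iff.2 (hX.rel_skeletal (φ := ψ))).symm⟩

variable (R B) in
/-- The bijection of the classification theorem. -/
noncomputable def H3.equivCrext : H3 R B ≃ Crext R B :=
  .ofBijective H3.toCrext ⟨H3.toCrext_injective, H3.toCrext_surjective⟩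

lemma CrossedExtension.IsCharacteristic.equivCrext_symm_mk {X : CrossedExtension R B} {φ : C3 R B}
    (h : X.IsCharacteristic φ.1) :
    (H3.equivCrext R B).symm (Quot.mk _ X) = QuotientAddGroup.mk ⟨φ, h.isCocycle⟩ :=
  (H3.equivCrext R B).symm_apply_eq.2
    (Crext.mk_eq_mk_iff.2 (h.rel_skeletal (φ := ⟨φ, h.isCocycle⟩)))

end SkeletalValuation

theorem theorem1 (R : Type u) [Ring R] (B : Type v) [AddCommGroup B] [Module R B] [Module Rᵐᵒᵖ B]
    [SMulCommClass R Rᵐᵒᵖ B] :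
    _root_.Equivalence (CrossedExtension.Rel (R := R) (B := B)) ∧
    ∃ e : H3 R B ≃ Crext R B,
      (∀ φ : Z3 R B, e (QuotientAddGroup.mk φ) = Quot.mk _ (skeletal φ)) ∧
      ∀ X : CrossedExtension R B,
        (∃ φ : C3 R B, X.IsCharacteristic φ.1) ∧
        ∀ φ : C3 R B, X.IsCharacteristic φ.1 →
          ∃ hφ : φ ∈ Z3 R B, e.symm (Quot.mk _ X) = QuotientAddGroup.mk ⟨φ, hφ⟩ := by
  refine ⟨CrossedExtension.rel_equivalence, H3.equivCrext R B, fun _ => rfl, fun X =>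
    ⟨?_, fun φ hX => ⟨hX.isCocycle, hX.equivCrext_symm_mk⟩⟩⟩
  obtain ⟨φ, hφ, hX⟩ := X.exists_isNormalized_isCharacteristic
  exact ⟨⟨φ, hφ⟩, hX⟩
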